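/- Let $n\ge 2$, let $U\subset\mathbb R\times\mathbb R^n$ be a connected open set with coordinates $(t,x)=(t,x_1,\dots,x_n)$, and let $$\frac{dx_i}{dt}=f_i(x_1,\dots,x_n),\qquad i=1,\dots,n,$$ be an autonomous system with functions $f_i$ that are smooth and nowhere zero on $U$. Put $\ell_{ij}=f_j\,\partial(\ln|f_i|)/\partial x_j$ for $i\ne j$, and suppose that for some pair $i\neq j$ the function $\ell_{ij}$ has no zero on $U$ (up to renumbering the $x_i$, that $\ell_{12}\ne0$ on $U$). A web symmetry of the system on $U$ is a diffeomorphism $\Phi:U\to U$ of the form $$\Phi(t,x_1,\dots,x_n)=(\varphi_0(t),\varphi_1(x_1),\dots,\varphi_n(x_n)),$$ with inverse of the same form, such that $$\Phi^*(dx_i-f_i\,dt)=\sum_{j=1}^n a_{ij}\,(dx_j-f_j\,dt),\qquad i=1,\dots,n,$$ for a smooth function $[a_{ij}]:U\to \mathrm{GL}(n,\mathbb R)$. Then the group of all web symmetries of the system on $U$, with the compact-open topology, is a finite-dimensional (Hausdorff, second countable) Lie group of dimension at most $n+1$, and it acts smoothly on $U$. -/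

import Mathlib

open Set Topology Manifold TopologicalSpace
open scoped ContDiff

noncomputable section

/-- The space `ℝ × ℝⁿ` of the variables `(t, x)`, `x = (x₁, …, xₙ)`. -/
abbrev TX (n : ℕ) : Type := ℝ × (Fin n → ℝ)

/-- The one-form `dx_i - f_i(x) dt` at the point `p = (t, x)`. -/
def contactForm {n : ℕ} (f : (Fin n → ℝ) → Fin n → ℝ) (i : Fin n) (p : TX n) : TX n →L[ℝ] ℝ :=
  (ContinuousLinearMap.proj i).comp (ContinuousLinearMap.snd ℝ ℝ (Fin n → ℝ)) -
    f p.2 i • ContinuousLinearMap.fst ℝ ℝ (Fin n → ℝ)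

/-- The function `ℓ_{ij} = f_j ∂(ln |f_i|)/∂x_j`. -/
def ell {n : ℕ} (f : (Fin n → ℝ) → Fin n → ℝ) (i j : Fin n) (x : Fin n → ℝ) : ℝ :=
  f x j * fderiv ℝ (fun y => Real.log |f y i|) x (Pi.single j 1)

/-- `Φ(t, x₁, …, xₙ) = (φ₀(t), φ₁(x₁), …, φₙ(xₙ))` on `U`. -/
def IsWebMap {n : ℕ} {U : Opens (TX n)} (Φ : U → U) : Prop :=
  ∃ (φ₀ : ℝ → ℝ) (φ : Fin n → ℝ → ℝ), ∀ p : U,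
    (Φ p : TX n) = (φ₀ p.1.1, fun i => φ i (p.1.2 i))

/-- `Φ` is a symmetry of the system `dx_i/dt = f_i(x)`:
`Φ^*(dx_i - f_i dt) = ∑ j, a_{ij} (dx_j - f_j dt)` for a smooth function
`[a_{ij}] : U → GL(n, ℝ)`. -/
def PreservesSystem {n : ℕ} (f : (Fin n → ℝ) → Fin n → ℝ) {U : Opens (TX n)} (Φ : U → U) : Prop :=
  ∃ a : U → Matrix (Fin n) (Fin n) ℝ,
    (∀ i j, ContMDiff 𝓘(ℝ, TX n) 𝓘(ℝ, ℝ) ∞ (fun p => a p i j)) ∧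
    (∀ p, IsUnit (a p).det) ∧
    ∀ (p : U) (i : Fin n) (v : TX n),
      contactForm f i (Φ p) (mfderiv 𝓘(ℝ, TX n) 𝓘(ℝ, TX n) Φ p v) =
        ∑ j, a p i j * contactForm f j p v

/-- Web symmetries of the system on `U`: diffeomorphisms of `U` which, with their inverses, have the
form of a web transformation, and which preserve the system. -/
structure IsWebSymmetry {n : ℕ} (f : (Fin n → ℝ) → Fin n → ℝ) {U : Opens (TX n)}
    (Φ : U ≃ₜ U) : Prop where
  smooth : ContMDiff 𝓘(ℝ, TX n) 𝓘(ℝ, TX n) ∞ Φ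
  smooth_symm : ContMDiff 𝓘(ℝ, TX n) 𝓘(ℝ, TX n) ∞ Φ.symm
  web : IsWebMap Φ
  web_symm : IsWebMap Φ.symm
  preserves : PreservesSystem f Φ

theorem IsWebMap.comp {n : ℕ} {U : Opens (TX n)} {Φ Ψ : U → U} (hΦ : IsWebMap Φ)
    (hΨ : IsWebMap Ψ) : IsWebMap (Φ ∘ Ψ) := by
  obtain ⟨φ₀, φ, h⟩ := hΦ
  obtain ⟨ψ₀, ψ, k⟩ := hΨ
  refine ⟨φ₀ ∘ ψ₀, fun i => φ i ∘ ψ i, fun p => ?_⟩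
  simp [h, k]

theorem PreservesSystem.comp {n : ℕ} {f : (Fin n → ℝ) → Fin n → ℝ} {U : Opens (TX n)}
    {Φ Ψ : U → U} (hΦ : PreservesSystem f Φ) (hΨ : PreservesSystem f Ψ)
    (sΦ : ContMDiff 𝓘(ℝ, TX n) 𝓘(ℝ, TX n) ∞ Φ) (sΨ : ContMDiff 𝓘(ℝ, TX n) 𝓘(ℝ, TX n) ∞ Ψ) :
    PreservesSystem f (Φ ∘ Ψ) := by
  obtain ⟨a, ha, hda, h⟩ := hΦ
  obtain ⟨b, hb, hdb, k⟩ := hΨ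
  refine ⟨fun p => a (Ψ p) * b p, fun i j => ?_, fun p => ?_, fun p i v => ?_⟩
  · simp only [Matrix.mul_apply]
    exact contMDiff_finsetSum fun l _ => ((ha i l).comp sΨ).mul (hb l j)
  · rw [Matrix.det_mul]; exact (hda _).mul (hdb _)
  · have hc := mfderiv_comp p (sΦ.mdifferentiable (by simp) (Ψ p)) (sΨ.mdifferentiable (by simp) p)
    rw [hc]
    have h1 := h (Ψ p) i (mfderiv 𝓘(ℝ, TX n) 𝓘(ℝ, TX n) Ψ p v)
    refine h1.trans ?_
    simp only [k, Matrix.mul_apply, Finset.mul_sum, Finset.sum_mul]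
    rw [Finset.sum_comm]
    simp only [mul_assoc]

theorem contMDiff_det_of_entries {n : ℕ} {U : Opens (TX n)} {a : U → Matrix (Fin n) (Fin n) ℝ}
    (ha : ∀ i j, ContMDiff 𝓘(ℝ, TX n) 𝓘(ℝ, ℝ) ∞ (fun p => a p i j)) :
    ContMDiff 𝓘(ℝ, TX n) 𝓘(ℝ, ℝ) ∞ (fun p => (a p).det) := by
  simp only [Matrix.det_apply']
  exact contMDiff_finsetSum fun σ _ => contMDiff_const.mul
    (contMDiff_finsetProd fun i _ => ha _ _)

theorem PreservesSystem.symm {n : ℕ} {f : (Fin n → ℝ) → Fin n → ℝ} {U : Opens (TX n)}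
    {Φ : U ≃ₜ U} (hΦ : PreservesSystem f Φ)
    (s : ContMDiff 𝓘(ℝ, TX n) 𝓘(ℝ, TX n) ∞ Φ)
    (s' : ContMDiff 𝓘(ℝ, TX n) 𝓘(ℝ, TX n) ∞ Φ.symm) :
    PreservesSystem f Φ.symm := by
  obtain ⟨a, ha, hda, h⟩ := hΦ
  refine ⟨fun p => (a (Φ.symm p))⁻¹, fun i j => ?_, fun p => ?_, fun p i v => ?_⟩
  · have key : ContMDiff 𝓘(ℝ, TX n) 𝓘(ℝ, ℝ) ∞ (fun p => (a p)⁻¹ i j) := by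
      simp only [Matrix.inv_def, Ring.inverse_eq_inv', Matrix.smul_apply, smul_eq_mul,
        Matrix.adjugate_apply]
      refine ((contMDiff_det_of_entries ha).inv₀ fun p => (hda p).ne_zero).mul
        (contMDiff_det_of_entries fun k l => ?_)
      simp only [Matrix.updateRow_apply]
      split_ifs
      · exact contMDiff_const
      · exact ha k l
    exact key.comp s'
  · exact Matrix.isUnit_nonsing_inv_det _ (hda _)
  · set w : TX n := mfderiv 𝓘(ℝ, TX n) 𝓘(ℝ, TX n) Φ.symm p v with hw
    have hc := mfderiv_comp p (s.mdifferentiable (by simp) (Φ.symm p))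
      (s'.mdifferentiable (by simp) p)
    have hid : (Φ : U → U) ∘ Φ.symm = id := by ext1 x; simp
    rw [hid, mfderiv_id] at hc
    have hv : mfderiv 𝓘(ℝ, TX n) 𝓘(ℝ, TX n) Φ (Φ.symm p) w = v :=
      (DFunLike.congr_fun hc v).symm
    have h1 : ∀ j, contactForm f j p v = ∑ l, a (Φ.symm p) j l * contactForm f l (Φ.symm p) w := by
      intro j
      have := h (Φ.symm p) j w
      rw [hv] at this
      simpa using this
    have h2 : (fun j => contactForm f j p v) =
        (a (Φ.symm p)).mulVec (fun l => contactForm f l (Φ.symm p) w) := funext h1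
    have h3 : (fun l => contactForm f l (Φ.symm p) w) =
        (a (Φ.symm p))⁻¹.mulVec (fun j => contactForm f j p v) := by
      rw [h2, Matrix.mulVec_mulVec, Matrix.nonsing_inv_mul _ (hda _), Matrix.one_mulVec]
    exact congrFun h3 i

/-- The web symmetries form a group under composition. -/
def webSymmetrySubgroup {n : ℕ} (f : (Fin n → ℝ) → Fin n → ℝ) (U : Opens (TX n)) :
    Subgroup (U ≃ₜ U) where
  carrier := {Φ | IsWebSymmetry f Φ}
  mul_mem' {Φ Ψ} hΦ hΨ :=
    { smooth := hΦ.smooth.comp hΨ.smooth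
      smooth_symm := hΨ.smooth_symm.comp hΦ.smooth_symm
      web := hΦ.web.comp hΨ.web
      web_symm := hΨ.web_symm.comp hΦ.web_symm
      preserves := hΦ.preserves.comp hΨ.preserves hΦ.smooth hΨ.smooth }
  one_mem' :=
    { smooth := contMDiff_id
      smooth_symm := contMDiff_id
      web := ⟨id, fun _ => id, fun _ => rfl⟩
      web_symm := ⟨id, fun _ => id, fun _ => rfl⟩
      preserves := by
        refine ⟨fun _ => 1, fun i j => contMDiff_const, fun p => by simp, fun p i v => ?_⟩
        have : mfderiv 𝓘(ℝ, TX n) 𝓘(ℝ, TX n) (⇑(1 : U ≃ₜ U)) p v = v :=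
          DFunLike.congr_fun (mfderiv_id (I := 𝓘(ℝ, TX n)) (x := p)) v
        rw [this]
        simp [Matrix.one_apply] }
  inv_mem' {Φ} hΦ :=
    { smooth := hΦ.smooth_symm
      smooth_symm := hΦ.smooth
      web := hΦ.web_symm
      web_symm := hΦ.web
      preserves := hΦ.preserves.symm hΦ.smooth hΦ.smooth_symm }

/-- The web symmetry group on `U` of the system `dx_i/dt = f_i(x)`. -/
abbrev WebSymmetryGroup {n : ℕ} (f : (Fin n → ℝ) → Fin n → ℝ) (U : Opens (TX n)) : Type :=
  webSymmetrySubgroup f U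

/-- The compact-open topology on the web symmetry group. -/
instance webSymmetryGroupTopology {n : ℕ} (f : (Fin n → ℝ) → Fin n → ℝ) (U : Opens (TX n)) :
    TopologicalSpace (WebSymmetryGroup f U) :=
  TopologicalSpace.induced (fun g => (⟨g.1, g.1.continuous⟩ : C(U, U))) inferInstance

end

/-!
A web symmetry `Φ = (φ₀, φ₁, …, φₙ)` satisfies `φᵢ' fᵢ = φ₀' · fᵢ ∘ Φ` and `φ₀' · ℓᵢⱼ ∘ Φ = ℓᵢⱼ`.
Since `ℓᵢⱼ` has no zero, the second relation determines `φ₀'`, and the components solve separable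
differential equations: near every point `Φ` is a smooth function of its value at that point. As
`U` is connected, the group acts freely, and it is closed under pointwise limits, so that it is
homeomorphic to a locally closed orbit in `U`. The displacement of a base point under a product of
two symmetries is the sum of the two displacements up to a quadratic error. As in the proof of the
closed subgroup theorem, the limiting directions of small displacements therefore form a linear
subspace of `ℝ × ℝⁿ`, over which the orbit is locally a smooth graph; the graphs are the charts,
and the dimension is at most `n + 1`.
-/

/-! ### Nearly additive maps -/

section

open Filter Asymptotics

theorem isBigO_of_isLittleO_sub_smul {W : Type*} [NormedAddCommGroup W] [NormedSpace ℝ W]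
    {w : ℝ → W} {v : W} {l : Filter ℝ} (hw : (fun s => w s - s • v) =o[l] fun s => s) :
    w =O[l] fun s : ℝ => s := by
  have hlin : (fun s : ℝ => s • v) =O[l] fun s => s :=
    .of_bound ‖v‖ (.of_forall fun s => by rw [norm_smul, mul_comm])
  exact (hw.isBigO.add hlin).congr_left fun s => by simp

/-- The vectors tangent at the origin to a curve in the range of `a`, as used for the tangent
space of a nearly additive map. The curve need not be continuous. -/
def IsTangentToRange {G W : Type*} [NormedAddCommGroup W] [NormedSpace ℝ W]
    (a : G → W) (v : W) : Prop :=
  ∃ g : ℝ → G, (fun s => a (g s) - s • v) =o[𝓝[>] 0] fun s => s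

theorem IsTangentToRange.pos_smul {G W : Type*} [NormedAddCommGroup W] [NormedSpace ℝ W]
    {a : G → W} {v : W} (hv : IsTangentToRange a v) {c : ℝ}
    (hc : 0 < c) : IsTangentToRange a (c • v) := by
  obtain ⟨g, hg⟩ := hv
  have hc0 : Tendsto (c * ·) (𝓝[>] 0) (𝓝[>] 0) := by
    simpa using TendstoNhdsWithinIoi.const_mul hc tendsto_id (b := c) (c := (0 : ℝ))
  refine ⟨fun s => g (c * s), ((hg.comp_tendsto hc0).trans_isBigO
    (isBigO_const_mul_self c _ _)).congr_left fun s => ?_⟩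
  simp only [Function.comp_apply, mul_smul, smul_comm s c v]

variable {G W : Type*} [Group G] [NormedAddCommGroup W]

/-- A map from a group to a normed space which is additive up to a quadratic error near the
identity and whose range is locally compact near the origin. It abstracts the map
`g ↦ g • o - o` of a closed group of transformations. The group carries no topology: all
smallness is measured by `‖a g‖`. -/
structure NearlyAdditive (a : G → W) (C r : ℝ) : Prop where
  const_nonneg : 0 ≤ C
  radius_pos : 0 < r
  map_one : a 1 = 0
  norm_map_mul_sub_sub_le : ∀ g h, ‖a g‖ < r → ‖a h‖ < r →
    ‖a (g * h) - a g - a h‖ ≤ C * ‖a g‖ * ‖a h‖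
  norm_map_inv_le : ∀ g, ‖a g‖ < r → ‖a g⁻¹‖ ≤ 2 * ‖a g‖
  isCompact_range_inter_closedBall : ∀ s < r, IsCompact (range a ∩ Metric.closedBall 0 s)

namespace NearlyAdditive

theorem exists_of_eventually {a : G → W} (hone : a 1 = 0)
    (hmul : (fun p : G × G => a (p.1 * p.2) - a p.1 - a p.2)
      =O[comap a (𝓝 0) ×ˢ comap a (𝓝 0)] fun p => ‖a p.1‖ * ‖a p.2‖)
    (hinv : ∀ᶠ g in comap a (𝓝 0), ‖a g⁻¹‖ ≤ 2 * ‖a g‖) {R : ℝ} (hR : 0 < R)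
    (hcompact : IsCompact (range a ∩ Metric.closedBall 0 R)) : ∃ C r, NearlyAdditive a C r := by
  obtain ⟨C, hC, hmulC⟩ := hmul.exists_nonneg
  have hbasis := (Metric.nhds_basis_ball (x := (0 : W))).comap a
  obtain ⟨s, hs, hmuls⟩ := hbasis.prod_self.eventually_iff.1 hmulC.bound
  obtain ⟨t, ht, hinvt⟩ := hbasis.eventually_iff.1 hinv
  refine ⟨C, min s (min t R), hC, by positivity, hone, fun g h hg hh => ?_, fun g hg => ?_,
    fun u hu => ?_⟩
  · rw [lt_min_iff] at hg hh
    simpa [mul_assoc] using @hmuls (g, h) ⟨mem_ball_zero_iff.2 hg.1, mem_ball_zero_iff.2 hh.1⟩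
  · exact hinvt (mem_ball_zero_iff.2 (lt_min_iff.1 (lt_min_iff.1 hg).2).1)
  · have hball : Metric.closedBall (0 : W) u ⊆ Metric.closedBall 0 R :=
      Metric.closedBall_subset_closedBall
        (hu.le.trans ((min_le_right _ _).trans (min_le_right _ _)))
    rw [← inter_eq_right.2 hball, ← inter_assoc]
    exact hcompact.inter_right Metric.isClosed_closedBall

variable {a : G → W} {C r : ℝ}

section Asymptotics

variable {ι : Type*} {l : Filter ι} {g h : ι → G}

theorem eventually_norm_lt (ha : NearlyAdditive a C r) (hg : Tendsto (a ∘ g) l (𝓝 0)) :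
    ∀ᶠ x in l, ‖a (g x)‖ < r :=
  hg.norm.eventually (gt_mem_nhds (by simpa using ha.radius_pos))

theorem isBigO_map_mul_sub_sub (ha : NearlyAdditive a C r) (hg : Tendsto (a ∘ g) l (𝓝 0))
    (hh : Tendsto (a ∘ h) l (𝓝 0)) :
    (fun x => a (g x * h x) - a (g x) - a (h x)) =O[l] fun x => ‖a (g x)‖ * ‖a (h x)‖ := by
  refine .of_bound C ?_
  filter_upwards [ha.eventually_norm_lt hg, ha.eventually_norm_lt hh] with x hgx hhx
  simpa [mul_assoc] using ha.norm_map_mul_sub_sub_le _ _ hgx hhx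

theorem isLittleO_map_mul_sub_sub (ha : NearlyAdditive a C r) {φ : ι → ℝ} (hφ : Tendsto φ l (𝓝 0))
    (hg : (a ∘ g) =O[l] φ) (hh : (a ∘ h) =O[l] φ) :
    (fun x => a (g x * h x) - a (g x) - a (h x)) =o[l] φ :=
  (ha.isBigO_map_mul_sub_sub (hg.trans_tendsto hφ) (hh.trans_tendsto hφ)).trans_isLittleO <| by
    simpa using ((isLittleO_one_iff ℝ).2 (hg.trans_tendsto hφ)).norm_left.mul_isBigO hh.norm_left

theorem isBigO_map_inv (ha : NearlyAdditive a C r) (hg : Tendsto (a ∘ g) l (𝓝 0)) :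
    (fun x => a (g x)⁻¹) =O[l] (a ∘ g) :=
  .of_bound 2 <| (ha.eventually_norm_lt hg).mono fun _ hx => ha.norm_map_inv_le _ hx

theorem tendsto_map_mul (ha : NearlyAdditive a C r) (hg : Tendsto (a ∘ g) l (𝓝 0))
    (hh : Tendsto (a ∘ h) l (𝓝 0)) : Tendsto (fun x => a (g x * h x)) l (𝓝 0) := by
  have herr : Tendsto (fun x => a (g x * h x) - a (g x) - a (h x)) l (𝓝 0) :=
    (ha.isBigO_map_mul_sub_sub hg hh).trans_tendsto (by simpa using hg.norm.mul hh.norm)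
  simpa using (herr.add hh).add hg

end Asymptotics

variable [NormedSpace ℝ W]

theorem norm_map_pow_sub_le (ha : NearlyAdditive a C r) {g : G} (hg : ‖a g‖ < r) {m : ℕ}
    (hm : 2 * (m * ‖a g‖) < r) (hC : C * (m * ‖a g‖) ≤ 1) :
    ‖a (g ^ m) - (m : ℝ) • a g‖ ≤ C * (m * ‖a g‖) ^ 2 := by
  have hC0 := ha.const_nonneg
  induction m with
  | zero => simp [ha.map_one]
  | succ m ih =>
    push_cast at hm hC ⊢
    have hn := norm_nonneg (a g)
    have hm0 : 0 ≤ (m : ℝ) * ‖a g‖ := by positivity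
    have hC' : C * (m * ‖a g‖) ≤ 1 := by nlinarith
    have ih := ih (by linarith) hC'
    have hpow : ‖a (g ^ m)‖ ≤ 2 * (m * ‖a g‖) := by
      have htri := norm_le_norm_sub_add (a (g ^ m)) ((m : ℝ) • a g)
      rw [norm_smul, Real.norm_natCast] at htri
      nlinarith
    have hstep : ‖a (g ^ m * g) - a (g ^ m) - a g‖ ≤ C * (2 * (m * ‖a g‖)) * ‖a g‖ :=
      (ha.norm_map_mul_sub_sub_le _ _ (by linarith) hg).trans (by gcongr)
    calc ‖a (g ^ (m + 1)) - ((m : ℝ) + 1) • a g‖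
        = ‖(a (g ^ m * g) - a (g ^ m) - a g) + (a (g ^ m) - (m : ℝ) • a g)‖ := by
          rw [pow_succ]; congr 1; module
      _ ≤ C * (2 * (m * ‖a g‖)) * ‖a g‖ + C * (m * ‖a g‖) ^ 2 := norm_add_le_of_le hstep ih
      _ ≤ C * ((m + 1) * ‖a g‖) ^ 2 := by nlinarith [mul_nonneg hC0 (mul_nonneg hn hn)]

theorem norm_map_pow_floor_sub_le (ha : NearlyAdditive a C r) {g : G} (hg : ‖a g‖ < r)
    (hg0 : a g ≠ 0) {s : ℝ} (hs : 0 ≤ s) (hsr : 2 * s < r) (hsC : C * s ≤ 1) :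
    ‖a (g ^ ⌊s / ‖a g‖⌋₊) - s • ‖a g‖⁻¹ • a g‖ ≤ C * s ^ 2 + ‖a g‖ := by
  have hC0 := ha.const_nonneg
  have hpos : 0 < ‖a g‖ := norm_pos_iff.2 hg0
  set m := ⌊s / ‖a g‖⌋₊
  have hms : m * ‖a g‖ ≤ s := (le_div_iff₀ hpos).1 (Nat.floor_le (by positivity))
  have hsm : s < (m + 1) * ‖a g‖ := (div_lt_iff₀ hpos).1 (Nat.lt_floor_add_one _)
  have hpow := ha.norm_map_pow_sub_le hg (m := m) (by linarith)
    ((mul_le_mul_of_nonneg_left hms hC0).trans hsC)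
  have hround : ‖(m : ℝ) • a g - s • ‖a g‖⁻¹ • a g‖ ≤ ‖a g‖ := by
    have hdir : (m : ℝ) • a g - s • ‖a g‖⁻¹ • a g = (m * ‖a g‖ - s) • ‖a g‖⁻¹ • a g := by
      rw [sub_smul, mul_smul, smul_inv_smul₀ hpos.ne']
    rw [hdir, norm_smul, norm_smul, norm_inv, norm_norm,
      inv_mul_cancel₀ hpos.ne', mul_one, Real.norm_eq_abs, abs_le]
    constructor <;> linarith
  have hsq : C * (m * ‖a g‖) ^ 2 ≤ C * s ^ 2 := by gcongr
  exact (norm_sub_le_norm_sub_add_norm_sub _ _ _).trans (add_le_add (hpow.trans hsq) hround)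

theorem isTangentToRange_of_tendsto (ha : NearlyAdditive a C r) {ι : Type*} {l : Filter ι} [l.NeBot]
    {g : ι → G} {v : W} (h0 : ∀ k, a (g k) ≠ 0) (hg : Tendsto (fun k => a (g k)) l (𝓝 0))
    (hv : Tendsto (fun k => ‖a (g k)‖⁻¹ • a (g k)) l (𝓝 v)) : IsTangentToRange a v := by
  have hex : ∀ᶠ s : ℝ in 𝓝[>] 0, ∃ h, ‖a h - s • v‖ ≤ (C + 2) * s ^ 2 := by
    have hsmall : ∀ᶠ s : ℝ in 𝓝[>] 0, 2 * s < r ∧ C * s < 1 := by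
      have hcont (c : ℝ) : ContinuousAt (c * ·) 0 := by fun_prop
      exact nhdsWithin_le_nhds (((hcont 2).eventually_lt_const (by simpa using ha.radius_pos)).and
        ((hcont C).eventually_lt_const (by simp)))
    filter_upwards [self_mem_nhdsWithin, hsmall] with s (hs : 0 < s) ⟨hsr, hsC⟩
    have hε : ∀ᶠ k in l, ‖a (g k)‖ < s ^ 2 :=
      hg.norm.eventually (gt_mem_nhds (by simpa using pow_pos hs 2))
    have hdir : ∀ᶠ k in l, ‖‖a (g k)‖⁻¹ • a (g k) - v‖ < s :=
      (tendsto_iff_norm_sub_tendsto_zero.1 hv).eventually (gt_mem_nhds hs)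
    obtain ⟨k, ⟨hkε, hkv⟩, hkr⟩ := ((hε.and hdir).and (ha.eventually_norm_lt hg)).exists
    refine ⟨g k ^ ⌊s / ‖a (g k)‖⌋₊,
      (norm_sub_le_norm_sub_add_norm_sub _ (s • ‖a (g k)‖⁻¹ • a (g k)) _).trans ?_⟩
    have hpow := ha.norm_map_pow_floor_sub_le hkr (h0 k) hs.le hsr hsC.le
    rw [← smul_sub, norm_smul, Real.norm_of_nonneg hs.le]
    nlinarith
  obtain ⟨h, hh⟩ := hex.choice
  refine ⟨h, (IsBigO.of_bound (C + 2) ?_).trans_isLittleO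
    ((isLittleO_pow_id one_lt_two).mono nhdsWithin_le_nhds)⟩
  simpa using hh

theorem isTangentToRange_add (ha : NearlyAdditive a C r) {v w : W} (hv : IsTangentToRange a v)
    (hw : IsTangentToRange a w) : IsTangentToRange a (v + w) := by
  obtain ⟨g, hg⟩ := hv
  obtain ⟨h, hh⟩ := hw
  have herr := ha.isLittleO_map_mul_sub_sub (tendsto_id.mono_left nhdsWithin_le_nhds)
    (isBigO_of_isLittleO_sub_smul hg) (isBigO_of_isLittleO_sub_smul hh)
  exact ⟨fun s => g s * h s, (herr.add (hg.add hh)).congr_left fun s => by module⟩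

theorem isTangentToRange_neg (ha : NearlyAdditive a C r) {v : W} (hv : IsTangentToRange a v) :
    IsTangentToRange a (-v) := by
  obtain ⟨g, hg⟩ := hv
  have h0 : Tendsto (fun s : ℝ => s) (𝓝[>] 0) (𝓝 0) := tendsto_id.mono_left nhdsWithin_le_nhds
  have hgO := isBigO_of_isLittleO_sub_smul hg
  have herr := ha.isLittleO_map_mul_sub_sub h0 hgO
    ((ha.isBigO_map_inv (hgO.trans_tendsto h0)).trans hgO)
  refine ⟨fun s => (g s)⁻¹, (herr.add hg).neg_left.congr_left fun s => ?_⟩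
  rw [mul_inv_cancel, ha.map_one]
  module

theorem isTangentToRange_zero (ha : NearlyAdditive a C r) : IsTangentToRange a 0 :=
  ⟨fun _ => 1, by simp [ha.map_one]⟩

/-- The tangent space at the origin of the range of a nearly additive map: the analogue of the Lie
algebra in the closed-subgroup theorem. -/
def tangentSpace (ha : NearlyAdditive a C r) : Submodule ℝ W where
  carrier := {v | IsTangentToRange a v}
  add_mem' := ha.isTangentToRange_add
  zero_mem' := ha.isTangentToRange_zero
  smul_mem' c v hv := by
    rcases lt_trichotomy c 0 with hc | rfl | hc
    · simpa using ha.isTangentToRange_neg (IsTangentToRange.pos_smul hv (neg_pos.2 hc))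
    · simpa using ha.isTangentToRange_zero
    · exact IsTangentToRange.pos_smul hv hc

end NearlyAdditive

end

section

open Filter Asymptotics

theorem contDiffOn_of_hasFDerivAt_comp {V W : Type*} [NormedAddCommGroup V] [NormedSpace ℝ V]
    [NormedAddCommGroup W] [NormedSpace ℝ W] {σ : V → W} {s : Set V} {t : Set W}
    {A : W → V →L[ℝ] W} (hs : IsOpen s) (hst : MapsTo σ s t) (hA : ContDiffOn ℝ ∞ A t)
    (hσ : ∀ z ∈ s, HasFDerivAt σ (A (σ z)) z) : ContDiffOn ℝ ∞ σ s := by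
  have hd : DifferentiableOn ℝ σ s := fun z hz => (hσ z hz).differentiableAt.differentiableWithinAt
  refine contDiffOn_infty.2 fun n => ?_
  induction n with
  | zero => exact contDiffOn_zero.2 hd.continuousOn
  | succ n ih =>
    rw [Nat.cast_succ, contDiffOn_succ_iff_fderiv_of_isOpen hs]
    exact ⟨hd, by simp, ((hA.of_le (by exact_mod_cast le_top)).comp ih hst).congr
      fun z hz => (hσ z hz).fderiv⟩

namespace NearlyAdditive

variable {G W : Type*} [Group G] [NormedAddCommGroup W] [NormedSpace ℝ W]
  {a : G → W} {C r : ℝ}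

theorem norm_proj_map_mul_sub_le (ha : NearlyAdditive a C r) {P : W →L[ℝ] ha.tangentSpace}
    (hP : ∀ v : ha.tangentSpace, P v = v) {g h : G} {s τ : ℝ} (hgs : ‖a g‖ < s) (hsr : s < r)
    (hsC : ‖P‖ * C * s ≤ 1 / 2) (hτ : 0 ≤ τ) (hτ1 : τ ≤ 1) (hh : ‖a h‖ < r) (z : ha.tangentSpace) :
    ‖P (a (g * h)) - z‖ ≤ (1 - τ / 2) * ‖P (a g) - z‖ +
      (‖P‖ + 1) * ‖a h - τ • ((z - P (a g) : ha.tangentSpace) : W)‖ := by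
  set u : ha.tangentSpace := z - P (a g) with hu
  set d := a h - τ • (u : W) with hd
  set e := a (g * h) - a g - a h with he
  have hC0 := ha.const_nonneg
  have hexp : P (a (g * h)) - z = -(1 - τ) • u + (P d + P e) := by
    have hPd : P d = P (a h) - τ • u := by rw [hd, map_sub, map_smul, hP]
    rw [hPd, he, map_sub, map_sub, hu]
    module
  have hah : ‖a h‖ ≤ ‖d‖ + τ * ‖u‖ := by
    simpa [norm_smul, abs_of_nonneg hτ] using norm_le_norm_sub_add (a h) (τ • (u : W))
  have hPe : ‖P e‖ ≤ 1 / 2 * (‖d‖ + τ * ‖u‖) :=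
    calc ‖P e‖ ≤ ‖P‖ * (C * s * ‖a h‖) := P.le_opNorm_of_le <|
          (ha.norm_map_mul_sub_sub_le g h (hgs.trans hsr) hh).trans (by gcongr)
      _ = ‖P‖ * C * s * ‖a h‖ := by ring
      _ ≤ 1 / 2 * (‖d‖ + τ * ‖u‖) := by gcongr
  have hu1 : ‖-(1 - τ) • u‖ = (1 - τ) * ‖u‖ := by
    rw [norm_smul, norm_neg, Real.norm_of_nonneg (by linarith)]
  rw [hexp, norm_sub_rev (P (a g)) z, ← hu]
  refine (norm_add_le_of_le hu1.le (norm_add_le_of_le (P.le_opNorm d) hPe)).trans ?_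
  linarith [norm_nonneg d]

theorem exists_norm_proj_sub_lt (ha : NearlyAdditive a C r) {P : W →L[ℝ] ha.tangentSpace}
    (hP : ∀ v : ha.tangentSpace, P v = v) {g : G} {s : ℝ} (hgs : ‖a g‖ < s) (hsr : s < r)
    (hsC : ‖P‖ * C * s ≤ 1 / 2) {z : ha.tangentSpace} (hz : P (a g) ≠ z) :
    ∃ h, ‖a h‖ ≤ s ∧ ‖P (a h) - z‖ < ‖P (a g) - z‖ := by
  have hu0 : 0 < ‖P (a g) - z‖ := norm_pos_iff.2 (sub_ne_zero.2 hz)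
  obtain ⟨k, hk⟩ := (z - P (a g)).2
  have hk0 : Tendsto (fun τ => a (k τ)) (𝓝[>] 0) (𝓝 0) :=
    (isBigO_of_isLittleO_sub_smul hk).trans_tendsto (tendsto_id.mono_left nhdsWithin_le_nhds)
  have hbound : ∀ᶠ τ in 𝓝[>] (0 : ℝ), ‖a g‖ + ‖a (k τ)‖ + C * ‖a g‖ * ‖a (k τ)‖ < s := by
    refine Tendsto.eventually_lt_const hgs ?_
    simpa using (hk0.norm.const_add ‖a g‖).add (hk0.norm.const_mul (C * ‖a g‖))
  have hsmall := hk.bound (c := ‖P (a g) - z‖ / (4 * (‖P‖ + 1))) (by positivity)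
  have hunit : ∀ᶠ τ in 𝓝[>] (0 : ℝ), τ ∈ Ioo 0 1 := Ioo_mem_nhdsGT one_pos
  obtain ⟨τ, ⟨⟨⟨hτ, hτ1⟩, hτr⟩, hτs⟩, hτk⟩ :=
    (((hunit.and (ha.eventually_norm_lt hk0)).and hbound).and hsmall).exists
  refine ⟨g * k τ, ?_, ?_⟩
  · have herr := ha.norm_map_mul_sub_sub_le g (k τ) (hgs.trans hsr) hτr
    have htri := norm_add₃_le (a := a (g * k τ) - a g - a (k τ)) (b := a (k τ)) (c := a g)
    rw [sub_add_cancel, sub_add_cancel] at htri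
    linarith
  · refine (ha.norm_proj_map_mul_sub_le hP hgs hsr hsC hτ.le hτ1.le hτr z).trans_lt ?_
    rw [Real.norm_of_nonneg hτ.le, div_mul_eq_mul_div, le_div_iff₀ (by positivity)] at hτk
    nlinarith

variable [FiniteDimensional ℝ W]

theorem isLittleO_sub_proj (ha : NearlyAdditive a C r) {P : W →L[ℝ] ha.tangentSpace}
    (hP : ∀ v : ha.tangentSpace, P v = v) :
    (fun g => a g - P (a g)) =o[comap a (𝓝 0)] a := by
  by_contra hcon
  obtain ⟨ε, hε, hfreq⟩ : ∃ ε > 0, ∃ᶠ g in comap a (𝓝 0), ε * ‖a g‖ < ‖a g - P (a g)‖ := by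
    simpa [isLittleO_iff] using hcon
  obtain ⟨g, hg, hgε⟩ := exists_seq_forall_of_frequently hfreq
  have h0 (k : ℕ) : a (g k) ≠ 0 := fun hk => by simpa [hk] using hgε k
  have hdir (k : ℕ) : ‖a (g k)‖⁻¹ • a (g k) ∈ Metric.sphere (0 : W) 1 := by
    simp [norm_smul, h0 k]
  obtain ⟨v, -, θ, hθ, hlim⟩ := (isCompact_sphere (0 : W) 1).tendsto_subseq hdir
  have hv : IsTangentToRange a v := ha.isTangentToRange_of_tendsto (fun k => h0 (θ k))
    (tendsto_comap_iff.1 (hg.comp hθ.tendsto_atTop)) hlim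
  have hPv : (P v : W) = v := congrArg Subtype.val (hP ⟨v, hv⟩)
  have hcont : Continuous fun w : W => ‖w - P w‖ := by fun_prop
  have hle : ε ≤ ‖v - P v‖ := by
    refine ge_of_tendsto' ((hcont.tendsto v).comp hlim) fun k => ?_
    have hpos : 0 < ‖a (g (θ k))‖ := norm_pos_iff.2 (h0 _)
    simp only [Function.comp_apply, map_smul, Submodule.coe_smul, ← smul_sub, norm_smul, norm_inv,
      norm_norm]
    rw [inv_mul_eq_div, le_div_iff₀ hpos]
    exact (hgε _).le
  rw [hPv, sub_self, norm_zero] at hle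
  exact hle.not_gt hε

theorem eventually_norm_le_proj (ha : NearlyAdditive a C r) {P : W →L[ℝ] ha.tangentSpace}
    (hP : ∀ v : ha.tangentSpace, P v = v) :
    ∀ᶠ g in comap a (𝓝 0), ‖a g‖ ≤ 2 * ‖P (a g)‖ := by
  filter_upwards [(ha.isLittleO_sub_proj hP).bound one_half_pos] with g hg
  have htri := norm_le_norm_sub_add (a g) (P (a g))
  rw [Submodule.coe_norm]
  linarith

theorem exists_proj_eq (ha : NearlyAdditive a C r) {P : W →L[ℝ] ha.tangentSpace}
    (hP : ∀ v : ha.tangentSpace, P v = v) :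
    ∃ ρ > 0, ∀ z : ha.tangentSpace, ‖z‖ < ρ → ∃ g, ‖a g‖ ≤ 4 * ‖z‖ ∧ P (a g) = z := by
  obtain ⟨δ, hδ, hproj⟩ := (Metric.nhds_basis_ball.comap a).eventually_iff.1
    (ha.eventually_norm_le_proj hP)
  have hC : ∀ᶠ s in 𝓝[>] (0 : ℝ), ‖P‖ * C * s ≤ 1 / 2 := nhdsWithin_le_nhds <|
    (Continuous.tendsto' (by fun_prop) 0 0 (by simp)).eventually_le_const one_half_pos
  have hrδ : ∀ᶠ s in 𝓝[>] (0 : ℝ), s ∈ Ioo 0 (min r δ) :=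
    Ioo_mem_nhdsGT (lt_min ha.radius_pos hδ)
  obtain ⟨s, hsC, hs0, hsrδ⟩ := (hC.and hrδ).exists
  obtain ⟨hsr, hsδ⟩ := lt_min_iff.1 hsrδ
  refine ⟨s / 4, by positivity, fun z hz => ?_⟩
  obtain ⟨_, ⟨⟨g, rfl⟩, hgs⟩, hmin⟩ := (ha.isCompact_range_inter_closedBall s hsr).exists_isMinOn
    ⟨0, ⟨1, ha.map_one⟩, by simp [hs0.le]⟩ (f := fun w => ‖P w - z‖) (by fun_prop)
  replace hmin (h : G) (hh : ‖a h‖ ≤ s) : ‖P (a g) - z‖ ≤ ‖P (a h) - z‖ :=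
    hmin ⟨⟨h, rfl⟩, by simpa using hh⟩
  have hgz : ‖a g‖ ≤ 4 * ‖z‖ := by
    have h1 : ‖P (a g) - z‖ ≤ ‖z‖ := by
      simpa [ha.map_one] using hmin 1 (by simp [ha.map_one, hs0.le])
    have hPg : ‖P (a g)‖ ≤ 2 * ‖z‖ := by linarith [norm_le_norm_sub_add (P (a g)) z]
    have hle : ‖a g‖ ≤ 2 * ‖P (a g)‖ := hproj (Metric.closedBall_subset_ball hsδ hgs)
    linarith
  refine ⟨g, hgz, by_contra fun hne => ?_⟩
  obtain ⟨h, hh, hlt⟩ := ha.exists_norm_proj_sub_lt hP (by linarith) hsr hsC hne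
  exact (hmin h hh).not_gt hlt

theorem eventually_norm_map_inv_mul_le (ha : NearlyAdditive a C r)
    {P : W →L[ℝ] ha.tangentSpace} (hP : ∀ v : ha.tangentSpace, P v = v) :
    ∀ᶠ p in comap a (𝓝 0) ×ˢ comap a (𝓝 0),
      ‖a (p.1⁻¹ * p.2)‖ ≤ 4 * ‖P (a p.2) - P (a p.1)‖ := by
  have h1 : Tendsto (fun p : G × G => a p.1) (comap a (𝓝 0) ×ˢ comap a (𝓝 0)) (𝓝 0) :=
    tendsto_comap.comp tendsto_fst
  have h2 : Tendsto (fun p : G × G => a p.2) (comap a (𝓝 0) ×ˢ comap a (𝓝 0)) (𝓝 0) :=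
    tendsto_comap.comp tendsto_snd
  have hk := ha.tendsto_map_mul ((ha.isBigO_map_inv h1).trans_tendsto h1) h2
  have hC : ∀ᶠ p : G × G in comap a (𝓝 0) ×ˢ comap a (𝓝 0), ‖P‖ * C * ‖a p.1‖ ≤ 1 / 4 :=
    (h1.norm.const_mul (‖P‖ * C)).eventually_le_const (by norm_num)
  filter_upwards [hC, ha.eventually_norm_lt h1, ha.eventually_norm_lt hk,
    (tendsto_comap_iff.2 hk).eventually (ha.eventually_norm_le_proj hP)] with ⟨g, h⟩ hC hg hk hproj
  dsimp only at hC hg hk hproj ⊢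
  set k := g⁻¹ * h with hk_def
  have herr : ‖P (a h - a g - a k)‖ ≤ 1 / 4 * ‖a k‖ := by
    have hmul := ha.norm_map_mul_sub_sub_le g k hg hk
    rw [hk_def, mul_inv_cancel_left, ← hk_def] at hmul
    calc _ ≤ ‖P‖ * (C * ‖a g‖ * ‖a k‖) := P.le_opNorm_of_le hmul
      _ = ‖P‖ * C * ‖a g‖ * ‖a k‖ := by ring
      _ ≤ _ := by gcongr
  have htri := norm_sub_le (P (a h) - P (a g)) (P (a h - a g - a k))
  rw [show P (a h) - P (a g) - P (a h - a g - a k) = P (a k) by simp] at htri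
  linarith

end NearlyAdditive

end

section

open Filter Asymptotics

theorem hasFDerivAt_section_of_isLittleO {V W : Type*} [NormedAddCommGroup V] [NormedSpace ℝ V]
    [NormedAddCommGroup W] [NormedSpace ℝ W] {σ : V → W} {P : W →L[ℝ] V} {M : V →L[ℝ] W}
    {Q : V →L[ℝ] V} {κ : V → V} {z : V} (hσ : ∀ᶠ z' in 𝓝 z, P (σ z') = z')
    (hκ : (fun z' => σ z' - σ z - M (κ z')) =o[𝓝 z] fun z' => z' - z)
    (hQ : Q ∘L (P ∘L M) = .id ℝ V) : HasFDerivAt σ (M ∘L Q) z := by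
  set R : V → W := fun z' => σ z' - σ z - M (κ z') with hR
  have hRo : (fun z' => R z' - M (Q (P (R z')))) =o[𝓝 z] fun z' => z' - z :=
    hκ.sub (((M ∘L Q ∘L P).isBigO_comp R _).trans_isLittleO hκ)
  refine .of_isLittleO (hRo.congr' ?_ .rfl)
  filter_upwards [hσ] with z' hz'
  have hQκ : Q (P (M (κ z'))) = κ z' := DFunLike.congr_fun hQ (κ z')
  simp only [hR, map_sub, hz', hσ.self_of_nhds, hQκ, ContinuousLinearMap.comp_apply]
  abel

theorem eventually_isUnit_and_contDiffAt {W : Type*} [NormedAddCommGroup W] [NormedSpace ℝ W]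
    [FiniteDimensional ℝ W] {T : Submodule ℝ W} {P : W →L[ℝ] T}
    (hP : ∀ v : T, P v = v) {L : W → W →L[ℝ] W} (hLs : ∀ᶠ w in 𝓝 0, ContDiffAt ℝ ∞ L w)
    (hL0 : L 0 = .id ℝ W) :
    ∀ᶠ w in 𝓝 0, IsUnit (P ∘L L w ∘L T.subtypeL) ∧ ContDiffAt ℝ ∞
      (fun w => (L w ∘L T.subtypeL) ∘L Ring.inverse (P ∘L L w ∘L T.subtypeL)) w := by
  set q : W → (T →L[ℝ] T) := fun w => P ∘L L w ∘L T.subtypeL with hq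
  have hqs {w : W} (hw : ContDiffAt ℝ ∞ L w) : ContDiffAt ℝ ∞ q w :=
    contDiffAt_const.clm_comp (hw.clm_comp contDiffAt_const)
  have hq0 : q 0 = 1 := by
    ext v
    simp [hq, hL0, hP]
  have hunit : ∀ᶠ w in 𝓝 0, IsUnit (q w) :=
    (hqs hLs.self_of_nhds).continuousAt.eventually
      (hq0 ▸ (Units.isOpen (R := T →L[ℝ] T)).mem_nhds isUnit_one)
  filter_upwards [hLs, hunit] with w hw ⟨u, hu⟩
  have hinv : ContDiffAt ℝ ∞ Ring.inverse (q w) := by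
    rw [← hu]
    exact contDiffAt_ringInverse (R := T →L[ℝ] T) ℝ u
  exact ⟨⟨u, hu⟩, (hw.clm_comp contDiffAt_const).clm_comp (hinv.comp w (hqs hw))⟩

namespace NearlyAdditive

variable {G W : Type*} [Group G] [NormedAddCommGroup W] [NormedSpace ℝ W] [FiniteDimensional ℝ W]
  {a : G → W} {C r : ℝ}

theorem hasFDerivAt_section (ha : NearlyAdditive a C r) {P : W →L[ℝ] ha.tangentSpace}
    (hP : ∀ v : ha.tangentSpace, P v = v) {γ : ha.tangentSpace → G} {z : ha.tangentSpace}
    (hγ : ∀ᶠ z' in 𝓝 z, P (a (γ z')) = z')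
    (hlip : ∀ᶠ z' in 𝓝 z, ‖a ((γ z)⁻¹ * γ z')‖ ≤ 4 * ‖z' - z‖) {L : W →L[ℝ] W}
    (hL : (fun k => a (γ z * k) - a (γ z) - L (a k)) =o[comap a (𝓝 0)] a)
    {Q : ha.tangentSpace →L[ℝ] ha.tangentSpace}
    (hQ : Q ∘L (P ∘L L ∘L ha.tangentSpace.subtypeL) = .id ℝ _) :
    HasFDerivAt (a ∘ γ) ((L ∘L ha.tangentSpace.subtypeL) ∘L Q) z := by
  set k : ha.tangentSpace → G := fun z' => (γ z)⁻¹ * γ z' with hk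
  refine hasFDerivAt_section_of_isLittleO (κ := fun z' => P (a (k z'))) hγ ?_ hQ
  have hkO : (fun z' => a (k z')) =O[𝓝 z] fun z' => z' - z := .of_bound 4 hlip
  have hk0 : Tendsto k (𝓝 z) (comap a (𝓝 0)) :=
    tendsto_comap_iff.2 (hkO.trans_tendsto (tendsto_sub_nhds_zero_iff.2 tendsto_id))
  have hLk := (hL.comp_tendsto hk0).trans_isBigO hkO
  have hPk := (L.isBigO_comp _ _).trans_isLittleO
    (((ha.isLittleO_sub_proj hP).comp_tendsto hk0).trans_isBigO hkO)
  refine (hLk.add hPk).congr_left fun z' => ?_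
  simp [hk]

theorem exists_section (ha : NearlyAdditive a C r) {P : W →L[ℝ] ha.tangentSpace}
    (hP : ∀ v : ha.tangentSpace, P v = v) {ε : ℝ} (hε : 0 < ε) :
    ∃ ρ > 0, ∃ γ : ha.tangentSpace → G,
      ∀ z ∈ Metric.ball 0 ρ, P (a (γ z)) = z ∧ ‖a (γ z)‖ < ε := by
  obtain ⟨ρ, hρ, hsurj⟩ := ha.exists_proj_eq hP
  have hex (z : ha.tangentSpace) : ∃ g, z ∈ Metric.ball 0 (min ρ (ε / 4)) →
      P (a g) = z ∧ ‖a g‖ < ε := by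
    by_cases hz : z ∈ Metric.ball 0 (min ρ (ε / 4))
    · obtain ⟨hzρ, hzε⟩ := lt_min_iff.1 (mem_ball_zero_iff.1 hz)
      obtain ⟨g, hg, hPg⟩ := hsurj z hzρ
      exact ⟨g, fun _ => ⟨hPg, by linarith⟩⟩
    · exact ⟨1, fun h => absurd h hz⟩
  choose γ hγ using hex
  exact ⟨_, by positivity, γ, hγ⟩

theorem exists_contDiffOn_section_tangentSpace (ha : NearlyAdditive a C r)
    {P : W →L[ℝ] ha.tangentSpace} (hP : ∀ v : ha.tangentSpace, P v = v) {L : W → W →L[ℝ] W}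
    (hLs : ∀ᶠ w in 𝓝 0, ContDiffAt ℝ ∞ L w) (hL0 : L 0 = .id ℝ W)
    (hL : ∀ᶠ g in comap a (𝓝 0),
      (fun k => a (g * k) - a g - L (a g) (a k)) =o[comap a (𝓝 0)] a) :
    ∃ ρ > 0, ∃ δ > 0, ∃ γ : ha.tangentSpace → G,
      (∀ z ∈ Metric.ball 0 ρ, P (a (γ z)) = z ∧ ‖a (γ z)‖ < δ) ∧
      ContDiffOn ℝ ∞ (a ∘ γ) (Metric.ball 0 ρ) ∧
      ∀ g, ‖a g‖ < δ → P (a g) ∈ Metric.ball 0 ρ → a (g⁻¹ * γ (P (a g))) = 0 := by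
  obtain ⟨δ, hδ, hlip⟩ := (Metric.nhds_basis_ball.comap a).prod_self.eventually_iff.1
    (ha.eventually_norm_map_inv_mul_le hP)
  obtain ⟨η, hη, hsmooth⟩ :=
    Metric.eventually_nhds_iff_ball.1 (eventually_isUnit_and_contDiffAt hP hLs hL0)
  replace hlip {g h : G} (hg : ‖a g‖ < δ) (hh : ‖a h‖ < δ) :
      ‖a (g⁻¹ * h)‖ ≤ 4 * ‖P (a h) - P (a g)‖ :=
    @hlip (g, h) ⟨mem_ball_zero_iff.2 hg, mem_ball_zero_iff.2 hh⟩
  obtain ⟨t, ht, hLt⟩ := (Metric.nhds_basis_ball.comap a).eventually_iff.1 hL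
  obtain ⟨ρ, hρ, γ, hγ⟩ := ha.exists_section hP (lt_min hδ (lt_min hη ht))
  simp only [lt_min_iff] at hγ
  refine ⟨ρ, hρ, δ, hδ, γ, fun z hz => ⟨(hγ z hz).1, (hγ z hz).2.1⟩,
    contDiffOn_of_hasFDerivAt_comp (t := Metric.ball 0 η) Metric.isOpen_ball
      (fun z hz => mem_ball_zero_iff.2 (hγ z hz).2.2.1)
      (fun w hw => (hsmooth w hw).2.contDiffWithinAt) fun z hz => ?_, fun g hg hgρ => ?_⟩
  · obtain ⟨hPz, hzδ, hzη, hzt⟩ := hγ z hz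
    have hball : ∀ᶠ z' in 𝓝 z, z' ∈ Metric.ball 0 ρ := Metric.isOpen_ball.mem_nhds hz
    refine ha.hasFDerivAt_section hP (hball.mono fun z' h' => (hγ z' h').1)
      (hball.mono fun z' h' => ?_) (hLt (mem_ball_zero_iff.2 hzt))
      (Ring.inverse_mul_cancel _ (hsmooth _ (mem_ball_zero_iff.2 hzη)).1)
    simpa only [hPz, (hγ z' h').1] using hlip hzδ (hγ z' h').2.1
  · obtain ⟨hPz, hzδ, -⟩ := hγ _ hgρ
    simpa [hPz] using hlip hg hzδ

theorem exists_contDiffOn_section (ha : NearlyAdditive a C r) {L : W → W →L[ℝ] W}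
    (hLs : ∀ᶠ w in 𝓝 0, ContDiffAt ℝ ∞ L w) (hL0 : L 0 = .id ℝ W)
    (hL : ∀ᶠ g in comap a (𝓝 0),
      (fun k => a (g * k) - a g - L (a g) (a k)) =o[comap a (𝓝 0)] a) :
    ∃ k ≤ Module.finrank ℝ W, ∃ (P : W →L[ℝ] EuclideanSpace ℝ (Fin k))
      (B : Set (EuclideanSpace ℝ (Fin k))) (δ : ℝ) (γ : EuclideanSpace ℝ (Fin k) → G),
      IsOpen B ∧ 0 ∈ B ∧ 0 < δ ∧ (∀ z ∈ B, P (a (γ z)) = z ∧ ‖a (γ z)‖ < δ) ∧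
      ContDiffOn ℝ ∞ (a ∘ γ) B ∧
      ∀ g, ‖a g‖ < δ → P (a g) ∈ B → a (g⁻¹ * γ (P (a g))) = 0 := by
  obtain ⟨P, hP⟩ := Submodule.ClosedComplemented.of_finiteDimensional ha.tangentSpace
  obtain ⟨ρ, hρ, δ, hδ, γ, hγ, hγs, hinj⟩ :=
    ha.exists_contDiffOn_section_tangentSpace hP hLs hL0 hL
  let e : ha.tangentSpace ≃L[ℝ] EuclideanSpace ℝ (Fin (Module.finrank ℝ ha.tangentSpace)) :=
    .ofFinrankEq (by simp)
  refine ⟨_, Submodule.finrank_le _, e.toContinuousLinearMap ∘L P, e.symm ⁻¹' Metric.ball 0 ρ, δ,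
    γ ∘ e.symm, Metric.isOpen_ball.preimage e.symm.continuous, by simpa using hρ, hδ,
    fun z hz => ⟨?_, (hγ _ hz).2⟩, hγs.comp e.symm.contDiff.contDiffOn fun z hz => hz,
    fun g hg hgB => ?_⟩
  · simp [(hγ _ hz).1]
  · simpa using hinj g hg (by simpa using hgB)

end NearlyAdditive

end

/-! ### Rigid transformation groups -/

section

open Filter

/-- A group of homeomorphisms of an open set whose elements `g` are, locally, given by a smooth
formula `g y = E (x, g x, y)`. -/
structure HasLocalFormula {W : Type*} [NormedAddCommGroup W] [NormedSpace ℝ W] {U : Opens W}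
    (H : Subgroup (U ≃ₜ U)) : Prop where
  exists_formula : ∀ q b : U, ∃ E : W × W × W → W,
    (∀ᶠ z in 𝓝 ((q : W), (b : W), (q : W)), ContDiffAt ℝ ∞ E z) ∧ E (q, b, q) = b ∧
    ∀ᶠ z : U × U × U in 𝓝 (q, b, q), ∀ g ∈ H, g z.1 = z.2.1 →
      (g z.2.2 : W) = E (z.1, z.2.1, z.2.2)

/-- A group of homeomorphisms of an open set is rigid if its elements are given by a local smooth
formula, and if it is closed under pointwise convergence of the transformations together with
their inverses. -/
structure RigidGroup {W : Type*} [NormedAddCommGroup W] [NormedSpace ℝ W] {U : Opens W}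
    (H : Subgroup (U ≃ₜ U)) : Prop extends HasLocalFormula H where
  closed : ∀ (l : Filter H) [l.NeBot] (Φ Ψ : U → U),
    (∀ q, Tendsto (fun g : H => g.1 q) l (𝓝 (Φ q))) →
    (∀ q, Tendsto (fun g : H => g.1.symm q) l (𝓝 (Ψ q))) → ∃ g : H, ∀ q, g.1 q = Φ q

/-- Near `z`, the elements `g` of `H` satisfy `g y = E (x, g x, y)`, and `E` is continuous at
`z`. -/
structure IsFormulaAt {X : Type*} [TopologicalSpace X] (H : Subgroup (X ≃ₜ X))
    (E : X × X × X → X) (z : X × X × X) : Prop where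
  continuousAt : ContinuousAt E z
  eventually_eq : ∀ᶠ z' in 𝓝 z, ∀ g ∈ H, g z'.1 = z'.2.1 → g z'.2.2 = E z'

theorem IsFormulaAt.tendsto_apply {X : Type*} [TopologicalSpace X] {H : Subgroup (X ≃ₜ X)}
    {E : X × X × X → X} {ι : Type*} {l : Filter ι} {Φ : ι → H} {x y : ι → X} {q b p : X}
    (hE : IsFormulaAt H E (q, b, p)) (hx : Tendsto x l (𝓝 q))
    (hΦ : Tendsto (fun i => (Φ i).1 (x i)) l (𝓝 b)) (hy : Tendsto y l (𝓝 p)) :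
    Tendsto (fun i => (Φ i).1 (y i)) l (𝓝 (E (q, b, p))) := by
  have hz := hx.prodMk_nhds (hΦ.prodMk_nhds hy)
  refine (hE.continuousAt.tendsto.comp hz).congr' ?_
  filter_upwards [hz.eventually hE.eventually_eq] with i hi
  exact (hi _ (Φ i).2 rfl).symm

variable {W : Type*} [NormedAddCommGroup W] [NormedSpace ℝ W] {U : Opens W}
  {H : Subgroup (U ≃ₜ U)}

namespace HasLocalFormula

theorem exists_isFormulaAt (hH : HasLocalFormula H) (q b : U) :
    ∃ E : U × U × U → U, E (q, b, q) = b ∧ ∀ᶠ z in 𝓝 (q, b, q), IsFormulaAt H E z := by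
  classical
  obtain ⟨E, hE, hEb, hform⟩ := hH.exists_formula q b
  let c : U × U × U → W × W × W := fun z => (z.1, z.2.1, z.2.2)
  have hc : Continuous c := by fun_prop
  have hEc : ∀ᶠ z in 𝓝 (q, b, q), ContinuousAt (E ∘ c) z :=
    (hc.continuousAt.eventually hE).mono fun z hz => hz.continuousAt.comp hc.continuousAt
  have hEU : ∀ᶠ z in 𝓝 (q, b, q), E (c z) ∈ U :=
    hEc.self_of_nhds.eventually_mem (U.isOpen.mem_nhds (by simp [c, hEb]))
  refine ⟨fun z => if h : E (c z) ∈ U then ⟨_, h⟩ else b, by simp [c, hEb], ?_⟩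
  filter_upwards [hEc, hEU.eventually_nhds, hform.eventually_nhds] with z hz hzU hzE
  refine ⟨IsInducing.subtypeVal.continuousAt_iff.2 (hz.congr ?_), ?_⟩
  · filter_upwards [hzU] with z' hz'
    simp [hz']
  · filter_upwards [hzU, hzE] with z' hz' hE' g hg hgz
    ext
    simp [hz', hE' g hg hgz, c]

theorem tendsto_apply_of_tendsto (hH : HasLocalFormula H) {ι : Type*} {l : Filter ι} {Φ : ι → H}
    {x y : ι → U} {q b : U} (hx : Tendsto x l (𝓝 q))
    (hΦ : Tendsto (fun i => (Φ i).1 (x i)) l (𝓝 b)) (hy : Tendsto y l (𝓝 q)) :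
    Tendsto (fun i => (Φ i).1 (y i)) l (𝓝 b) := by
  obtain ⟨E, hEb, hE⟩ := hH.exists_isFormulaAt q b
  exact hEb ▸ hE.self_of_nhds.tendsto_apply hx hΦ hy

theorem tendsto_symm_apply (hH : HasLocalFormula H) {ι : Type*} {l : Filter ι} {Φ : ι → H}
    {y b : U} (h : Tendsto (fun i => (Φ i).1 y) l (𝓝 b)) :
    Tendsto (fun i => (Φ i).1.symm b) l (𝓝 y) :=
  hH.tendsto_apply_of_tendsto (Φ := fun i => (Φ i)⁻¹) h
    (tendsto_const_nhds.congr fun i => ((Φ i).1.symm_apply_apply y).symm) tendsto_const_nhds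

theorem contMDiff_apply (hH : HasLocalFormula H) (g : H) :
    ContMDiff 𝓘(ℝ, W) 𝓘(ℝ, W) ∞ g.1 := by
  intro q
  rw [← ContMDiffAt.subtypeVal_comp_iff]
  obtain ⟨E, hE, -, hform⟩ := hH.exists_formula q (g.1 q)
  have hsmooth : ContMDiffAt 𝓘(ℝ, W) 𝓘(ℝ, W) ∞ (fun y : W => E (q, g.1 q, y)) q :=
    (hE.self_of_nhds.comp (f := fun y : W => ((q : W), (g.1 q : W), y)) (q : W)
      (by fun_prop)).contMDiffAt
  refine (contMDiffAt_subtype_iff.2 hsmooth).congr_of_eventuallyEq ?_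
  have hc : Tendsto (fun y : U => (q, g.1 q, y)) (𝓝 q) (𝓝 (q, g.1 q, q)) :=
    Continuous.tendsto' (by fun_prop) _ _ rfl
  filter_upwards [hc.eventually hform] with y hy
  exact hy g.1 g.2 rfl

theorem isOpen_setOf_exists_tendsto_apply (hH : HasLocalFormula H) {ι : Type*} {l : Filter ι}
    {Φ : ι → H} : IsOpen {q : U | ∃ c, Tendsto (fun i => (Φ i).1 q) l (𝓝 c)} := by
  rw [isOpen_iff_eventually]
  rintro q ⟨b, hb⟩
  obtain ⟨E, -, hE⟩ := hH.exists_isFormulaAt q b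
  have hc : Tendsto (fun y : U => (q, b, y)) (𝓝 q) (𝓝 (q, b, q)) :=
    Continuous.tendsto' (by fun_prop) _ _ rfl
  filter_upwards [hc.eventually hE] with y hy
  exact ⟨_, hy.tendsto_apply tendsto_const_nhds hb tendsto_const_nhds⟩

/- If `Φ i y → b` with `y` near `q`, then `(Φ j)⁻¹ b` is near `y` for some `j`, so the formula near
`(q, q, q)` shows that `(Φ j)⁻¹ (Φ i q)` converges. -/
theorem isClosed_setOf_exists_tendsto_apply (hH : HasLocalFormula H) {ι : Type*} {l : Filter ι}
    [l.NeBot] {Φ : ι → H} : IsClosed {q : U | ∃ c, Tendsto (fun i => (Φ i).1 q) l (𝓝 c)} := by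
  refine isClosed_iff_frequently.2 fun q hq => ?_
  obtain ⟨E, -, hE⟩ := hH.exists_isFormulaAt q q
  have hcq : Tendsto (fun y : U => (y, y, q)) (𝓝 q) (𝓝 (q, q, q)) :=
    Continuous.tendsto' (by fun_prop) _ _ rfl
  obtain ⟨y, ⟨b, hb⟩, hy⟩ := (hq.and_eventually (hcq.eventually hE.eventually_nhds)).exists
  have hcy : Tendsto (fun c : U => (y, c, q)) (𝓝 y) (𝓝 (y, y, q)) :=
    Continuous.tendsto' (by fun_prop) _ _ rfl
  obtain ⟨j, hj⟩ := ((hH.tendsto_symm_apply hb).eventually (hcy.eventually hy)).exists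
  have hlim := hj.tendsto_apply (Φ := fun i => (Φ j)⁻¹ * Φ i) tendsto_const_nhds
    (((Φ j).1.symm.continuous.tendsto b).comp hb) tendsto_const_nhds
  exact ⟨_, (((Φ j).1.continuous.tendsto _).comp hlim).congr fun i =>
    (Φ j).1.apply_symm_apply _⟩

variable [PreconnectedSpace U]

theorem eq_of_apply_eq (hH : HasLocalFormula H) {g h : H} {o : U} (ho : g.1 o = h.1 o) :
    g = h := by
  have hclopen : IsClopen {q : U | g.1 q = h.1 q} := by
    refine ⟨isClosed_eq g.1.continuous h.1.continuous, isOpen_iff_eventually.2 fun q hq => ?_⟩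
    obtain ⟨E, -, hE⟩ := hH.exists_isFormulaAt q (g.1 q)
    have hc : Tendsto (fun y : U => (q, g.1 q, y)) (𝓝 q) (𝓝 (q, g.1 q, q)) :=
      Continuous.tendsto' (by fun_prop) _ _ rfl
    filter_upwards [hc.eventually hE.self_of_nhds.eventually_eq] with y hy
    exact (hy g.1 g.2 rfl).trans (hy h.1 h.2 hq.symm).symm
  exact Subtype.ext (Homeomorph.ext (eq_univ_iff_forall.1 (hclopen.eq_univ ⟨o, ho⟩)))

theorem exists_tendsto_apply (hH : HasLocalFormula H) {ι : Type*} {l : Filter ι} [l.NeBot]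
    {Φ : ι → H} {o b : U} (h : Tendsto (fun i => (Φ i).1 o) l (𝓝 b)) (q : U) :
    ∃ c, Tendsto (fun i => (Φ i).1 q) l (𝓝 c) := by
  have huniv := IsClopen.eq_univ ⟨hH.isClosed_setOf_exists_tendsto_apply (l := l) (Φ := Φ),
    hH.isOpen_setOf_exists_tendsto_apply⟩ ⟨o, b, h⟩
  exact eq_univ_iff_forall.1 huniv q

end HasLocalFormula

namespace RigidGroup

variable [PreconnectedSpace U]

theorem exists_forall_tendsto (hH : RigidGroup H) {ι : Type*} {l : Filter ι} [l.NeBot]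
    {Φ : ι → H} {o b : U} (h : Tendsto (fun i => (Φ i).1 o) l (𝓝 b)) :
    ∃ g : H, g.1 o = b ∧ ∀ q, Tendsto (fun i => (Φ i).1 q) l (𝓝 (g.1 q)) := by
  choose F hF using hH.exists_tendsto_apply h
  choose F' hF' using hH.exists_tendsto_apply (Φ := fun i => (Φ i)⁻¹) (hH.tendsto_symm_apply h)
  obtain ⟨g, hg⟩ := hH.closed (l.map Φ) F F' (fun q => tendsto_map'_iff.2 (hF q))
    (fun q => tendsto_map'_iff.2 (hF' q))
  exact ⟨g, (hg o).trans (tendsto_nhds_unique (hF o) h), fun q => hg q ▸ hF q⟩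

theorem isClosed_range_apply (hH : RigidGroup H) (o : U) :
    IsClosed (range fun g : H => g.1 o) := by
  refine isClosed_iff_frequently.2 fun b hb => ?_
  have : (comap (fun g : H => g.1 o) (𝓝 b)).NeBot := comap_neBot_iff_frequently.2 hb
  obtain ⟨g, hg, -⟩ := hH.exists_forall_tendsto (Φ := id)
    (tendsto_comap : Tendsto (fun g : H => g.1 o) (comap _ (𝓝 b)) _)
  exact ⟨g, hg⟩

theorem continuous_action [TopologicalSpace H] (hH : RigidGroup H) {o : U}
    (ho : IsInducing fun g : H => g.1 o) : Continuous fun z : H × U => z.1.1 z.2 := by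
  refine continuous_iff_continuousAt.2 fun ⟨g, q⟩ => ?_
  have hlim : Tendsto (fun z : H × U => z.1.1 o) (𝓝 (g, q)) (𝓝 (g.1 o)) :=
    (ho.continuous.comp continuous_fst).tendsto (g, q)
  obtain ⟨g', hg', h⟩ := hH.exists_forall_tendsto (Φ := Prod.fst) hlim
  obtain rfl := hH.eq_of_apply_eq hg'
  exact hH.tendsto_apply_of_tendsto (Φ := Prod.fst) tendsto_const_nhds (h q)
    (continuous_snd.tendsto (g', q))

theorem isEmbedding_apply [TopologicalSpace H] (hH : RigidGroup H)
    (hτ : IsInducing fun g : H => (⟨g.1, g.1.continuous⟩ : C(U, U))) (o : U) :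
    IsEmbedding fun g : H => g.1 o := by
  refine ⟨⟨le_antisymm ?_ ?_⟩, fun g h => hH.eq_of_apply_eq⟩
  · exact continuous_iff_le_induced.1 ((continuous_eval_const (F := C(U, U)) o).comp hτ.continuous)
  · rw [hτ.eq_induced]
    let _ : TopologicalSpace H := .induced (fun g => g.1 o) inferInstance
    exact continuous_iff_le_induced.1 (ContinuousMap.continuous_of_continuous_uncurry
      (fun g : H => (⟨g.1, g.1.continuous⟩ : C(U, U))) (hH.continuous_action ⟨rfl⟩))

end RigidGroup

end

section

open Filter Asymptotics

theorem isBigO_sub_sub_add_of_contDiffAt {V V' W : Type*} [NormedAddCommGroup V] [NormedSpace ℝ V]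
    [NormedAddCommGroup V'] [NormedSpace ℝ V'] [NormedAddCommGroup W] [NormedSpace ℝ W]
    {m : V × V' → W} {a : V} {b : V'} (hm : ContDiffAt ℝ 2 m (a, b)) :
    (fun z => m z - m (z.1, b) - (m (a, z.2) - m (a, b)))
      =O[𝓝 (a, b)] fun z => ‖z.1 - a‖ * ‖z.2 - b‖ := by
  let D : V × V' → V' →L[ℝ] W := fun z => fderiv ℝ m z ∘L .inr ℝ V V'
  have hD : ContDiffAt ℝ 1 D (a, b) :=
    (hm.fderiv_right (by norm_num)).clm_comp contDiffAt_const
  obtain ⟨K, t, ht, hK⟩ := hD.exists_lipschitzOnWith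
  have hgood : ∀ᶠ z in 𝓝 (a, b), z ∈ t ∧ HasFDerivAt (fun y => m (z.1, y)) (D z) z.2 := by
    filter_upwards [ht, hm.eventually (by simp)] with z hz hmz
    exact ⟨hz, (hmz.differentiableAt (by simp)).hasFDerivAt.comp (f := fun y => (z.1, y)) z.2
      (hasFDerivAt_prodMk_right z.1 z.2)⟩
  obtain ⟨s, hs, hst⟩ := Metric.eventually_nhds_iff_ball.1 hgood
  simp only [← ball_prod_same] at hst
  refine .of_bound K (Metric.eventually_nhds_iff_ball.2 ⟨s, hs, fun ⟨x, y⟩ hxy => ?_⟩)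
  rw [← ball_prod_same] at hxy
  have hmvt := (convex_ball b s).norm_image_sub_le_of_norm_hasFDerivWithin_le
    (f := fun w => m (x, w) - m (a, w)) (f' := fun w => D (x, w) - D (a, w)) (C := K * ‖x - a‖)
    (fun w hw => ((hst (x, w) ⟨hxy.1, hw⟩).2.sub
      (hst (a, w) ⟨Metric.mem_ball_self hs, hw⟩).2).hasFDerivWithinAt)
    (fun w hw => ?_) (Metric.mem_ball_self hs) hxy.2
  · rw [Real.norm_of_nonneg (by positivity), ← mul_assoc]
    convert hmvt using 2
    abel
  · have := hK.dist_le_mul _ (hst (x, w) ⟨hxy.1, hw⟩).1 _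
      (hst (a, w) ⟨Metric.mem_ball_self hs, hw⟩).1
    rwa [dist_eq_norm, dist_prod_same_right, dist_eq_norm x] at this

variable {W : Type*} [NormedAddCommGroup W] {U : Opens W} {H : Subgroup (U ≃ₜ U)}

namespace RigidGroup

/-- The displacement of the base point `o`. For a rigid group it is nearly additive, and it embeds
the group in the ambient space. -/
def displacement (H : Subgroup (U ≃ₜ U)) (o : U) (g : H) : W := (g.1 o : W) - o

theorem displacement_add (o : U) (g : H) : displacement H o g + o = g.1 o := by
  simp [displacement]

theorem displacement_one (o : U) : displacement H o 1 = 0 := by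
  simp [displacement]

theorem displacement_mul (o : U) (g h : H) :
    displacement H o (g * h) = (g.1 (h.1 o) : W) - o := rfl

theorem tendsto_apply_comap_displacement (o : U) :
    Tendsto (fun g : H => g.1 o) (comap (displacement H o) (𝓝 0)) (𝓝 o) := by
  rw [IsInducing.subtypeVal.tendsto_nhds_iff]
  simpa [displacement_add, Function.comp_def] using
    (tendsto_comap (f := displacement H o) (x := 𝓝 0)).add_const (o : W)

theorem eventually_eq_of_eventually_apply_eq {o : U} {m : W × W → W}
    (hform : ∀ᶠ z : U × U in 𝓝 (o, o), ∀ g ∈ H, g o = z.1 → (g z.2 : W) = m (z.1, z.2)) :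
    ∀ᶠ y in 𝓝 (o : W), m (o, y) = y := by
  have hc : Tendsto (fun y : U => (o, y)) (𝓝 o) (𝓝 (o, o)) :=
    Continuous.tendsto' (by fun_prop) _ _ rfl
  rw [← U.isOpenEmbedding'.map_nhds_eq o, eventually_map]
  filter_upwards [hc.eventually hform] with y hy
  exact (hy 1 H.one_mem rfl).symm

end RigidGroup

variable [NormedSpace ℝ W]

open RigidGroup

namespace HasLocalFormula

theorem exists_eventually_apply_eq (hH : HasLocalFormula H) (o : U) : ∃ m : W × W → W,
    (∀ᶠ z in 𝓝 ((o : W), (o : W)), ContDiffAt ℝ ∞ m z) ∧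
    ∀ᶠ z : U × U in 𝓝 (o, o), ∀ g ∈ H, g o = z.1 → (g z.2 : W) = m (z.1, z.2) := by
  obtain ⟨E, hE, -, hform⟩ := hH.exists_formula o o
  have hcW : Continuous fun z : W × W => ((o : W), z.1, z.2) := by fun_prop
  have hcU : Continuous fun z : U × U => (o, z.1, z.2) := by fun_prop
  refine ⟨fun z => E (o, z.1, z.2), ?_, (hcU.tendsto (o, o)).eventually hform⟩
  filter_upwards [hcW.continuousAt.eventually hE] with z hz
  exact hz.comp (f := fun z : W × W => ((o : W), z.1, z.2)) z (by fun_prop)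

section

variable {o : U} {m : W × W → W}
  (hform : ∀ᶠ z : U × U in 𝓝 (o, o), ∀ g ∈ H, g o = z.1 → (g z.2 : W) = m (z.1, z.2))
include hform

theorem isBigO_apply_sub_sub_displacement (hm : ContDiffAt ℝ 2 m ((o : W), (o : W))) :
    (fun p : H × U => (p.1.1 p.2 : W) - p.2 - displacement H o p.1)
      =O[comap (displacement H o) (𝓝 0) ×ˢ 𝓝 o]
      fun p => ‖displacement H o p.1‖ * ‖(p.2 : W) - o‖ := by
  have hid := eventually_eq_of_eventually_apply_eq hform
  have htend : Tendsto (fun p : H × U => (p.1.1 o, p.2)) (comap (displacement H o) (𝓝 0) ×ˢ 𝓝 o)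
      (𝓝 (o, o)) :=
    ((tendsto_apply_comap_displacement o).comp tendsto_fst).prodMk_nhds tendsto_snd
  have hcoe : Tendsto (fun z : U × U => ((z.1 : W), (z.2 : W))) (𝓝 (o, o)) (𝓝 ((o : W), (o : W))) :=
    Continuous.tendsto' (by fun_prop) _ _ rfl
  have hco : Tendsto (fun z : U × U => (z.1, o)) (𝓝 (o, o)) (𝓝 (o, o)) :=
    Continuous.tendsto' (by fun_prop) _ _ rfl
  refine ((isBigO_sub_sub_add_of_contDiffAt hm).comp_tendsto (hcoe.comp htend)).congr' ?_ .rfl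
  filter_upwards [htend.eventually hform, htend.eventually (hco.eventually hform),
    ((continuous_subtype_val.tendsto o).comp tendsto_snd).eventually hid]
    with p hp hpo hy
  simp only [Function.comp_apply, hid.self_of_nhds, displacement] at hy ⊢
  rw [hy, ← hp _ p.1.2 rfl, ← hpo _ p.1.2 rfl]
  abel

theorem isLittleO_displacement_mul_sub_sub (hm : ContDiffAt ℝ 1 m ((o : W), (o : W))) :
    ∀ᶠ g in comap (displacement H o) (𝓝 0),
      (fun k => displacement H o (g * k) - displacement H o g -
        (fderiv ℝ m (displacement H o g + o, (o : W)) ∘L .inr ℝ W W) (displacement H o k))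
        =o[comap (displacement H o) (𝓝 0)] displacement H o := by
  have hcU : Tendsto (fun x : U => (x, o)) (𝓝 o) (𝓝 (o, o)) :=
    Continuous.tendsto' (by fun_prop) _ _ rfl
  have hcW : Tendsto (fun x : U => ((x : W), (o : W))) (𝓝 o) (𝓝 ((o : W), (o : W))) :=
    Continuous.tendsto' (by fun_prop) _ _ rfl
  have htend := tendsto_apply_comap_displacement (H := H) o
  filter_upwards [htend.eventually (hcU.eventually hform.eventually_nhds),
    htend.eventually (hcW.eventually (hm.eventually (by simp)))] with g hg hmg
  have hderiv : HasFDerivAt (fun y => m (g.1 o, y)) (fderiv ℝ m (g.1 o, o) ∘L .inr ℝ W W) (o : W) :=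
    (hmg.differentiableAt (by simp)).hasFDerivAt.comp (f := fun y => ((g.1 o : W), y)) (o : W)
      (hasFDerivAt_prodMk_right _ _)
  refine ((hasFDerivAt_iff_isLittleO.1 hderiv).comp_tendsto
    ((continuous_subtype_val.tendsto o).comp htend)).congr' ?_ .rfl
  have hcg : Tendsto (fun y : U => (g.1 o, y)) (𝓝 o) (𝓝 (g.1 o, o)) :=
    Continuous.tendsto' (by fun_prop) _ _ rfl
  filter_upwards [htend.eventually (hcg.eventually hg)] with k hk
  simp only [Function.comp_apply, displacement_add, displacement_mul]
  rw [← hk _ g.2 rfl, ← hg.self_of_nhds _ g.2 rfl]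
  simp [displacement]

end

theorem isBigO_displacement_mul (hH : HasLocalFormula H) (o : U) :
    (fun p : H × H => displacement H o (p.1 * p.2) - displacement H o p.1 - displacement H o p.2)
      =O[comap (displacement H o) (𝓝 0) ×ˢ comap (displacement H o) (𝓝 0)]
      fun p => ‖displacement H o p.1‖ * ‖displacement H o p.2‖ := by
  obtain ⟨m, hm, hform⟩ := hH.exists_eventually_apply_eq o
  have htend := (tendsto_id (x := comap (displacement H o) (𝓝 0))).prodMap
    (tendsto_apply_comap_displacement (H := H) o)
  refine ((isBigO_apply_sub_sub_displacement hform
    (contDiffAt_infty.1 hm.self_of_nhds 2)).comp_tendsto htend).congr_left fun p => ?_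
  simp only [Function.comp_apply, Prod.map_fst, Prod.map_snd, id_eq, displacement_mul]
  simp only [displacement]
  abel

theorem eventually_norm_displacement_inv_le (hH : HasLocalFormula H) (o : U) :
    ∀ᶠ g in comap (displacement H o) (𝓝 0),
      ‖displacement H o g⁻¹‖ ≤ 2 * ‖displacement H o g‖ := by
  obtain ⟨m, hm, hform⟩ := hH.exists_eventually_apply_eq o
  obtain ⟨C, hbound⟩ := (isBigO_apply_sub_sub_displacement hform
    (contDiffAt_infty.1 hm.self_of_nhds 2)).bound
  have hinv : Tendsto (fun g : H => (g⁻¹).1 o) (comap (displacement H o) (𝓝 0)) (𝓝 o) :=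
    hH.tendsto_symm_apply (Φ := id) (tendsto_apply_comap_displacement o)
  have hsmall : ∀ᶠ g in comap (displacement H o) (𝓝 0), C * ‖displacement H o g‖ < 1 / 2 :=
    ((tendsto_comap (f := displacement H o)).norm.const_mul C).eventually_lt_const (by simp)
  filter_upwards [(tendsto_id.prodMk hinv).eventually hbound, hsmall] with g hg hgC
  set a := displacement H o g
  set b := displacement H o g⁻¹
  have hab : ‖b + a‖ ≤ C * ‖a‖ * ‖b‖ := by
    have hval : (g.1 ((g⁻¹).1 o) : W) = o := congrArg Subtype.val (g.1.apply_symm_apply o)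
    rw [← norm_neg (b + a)]
    simpa [a, b, displacement, hval, mul_assoc, sub_eq_add_neg, add_comm] using hg
  have htri := norm_sub_le (b + a) a
  rw [add_sub_cancel_right] at htri
  nlinarith [norm_nonneg b]

end HasLocalFormula

/-- A local parametrization, near the identity, of a transformation group by vectors of a normed
space `E`: the inverse `toFun` of a linear projection `proj` of the displacement of `o`, on those
elements which displace `o` by less than `radius`. -/
structure LocalParametrization (H : Subgroup (U ≃ₜ U)) (o : U) (E : Type*)
    [NormedAddCommGroup E] [NormedSpace ℝ E] where
  proj : W →L[ℝ] E
  domain : Set E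
  radius : ℝ
  toFun : E → H
  isOpen_domain : IsOpen domain
  zero_mem_domain : 0 ∈ domain
  radius_pos : 0 < radius
  proj_displacement : ∀ z ∈ domain, proj (displacement H o (toFun z)) = z
  norm_displacement_lt : ∀ z ∈ domain, ‖displacement H o (toFun z)‖ < radius
  contDiffOn : ContDiffOn ℝ ∞ (displacement H o ∘ toFun) domain
  toFun_proj : ∀ g, ‖displacement H o g‖ < radius → proj (displacement H o g) ∈ domain →
    toFun (proj (displacement H o g)) = g

namespace RigidGroup

variable [FiniteDimensional ℝ W] [PreconnectedSpace U]

theorem isCompact_range_displacement_inter (hH : RigidGroup H) (o : U) {s : ℝ}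
    (hs : Metric.closedBall (o : W) s ⊆ U) :
    IsCompact (range (displacement H o) ∩ Metric.closedBall 0 s) := by
  have hball : IsCompact (((↑) : U → W) ⁻¹' Metric.closedBall (o : W) s) :=
    IsInducing.subtypeVal.isCompact_preimage' (isCompact_closedBall _ _) (by simpa using hs)
  have hcompact := (hball.inter_left (hH.isClosed_range_apply o)).image
    (f := fun x : U => (x : W) - o) (by fun_prop)
  convert hcompact using 1
  ext w
  constructor
  · rintro ⟨⟨g, rfl⟩, hg⟩
    exact ⟨g.1 o, ⟨⟨g, rfl⟩, by simpa [Subtype.dist_eq, dist_eq_norm, displacement] using hg⟩, rfl⟩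
  · rintro ⟨x, ⟨⟨g, rfl⟩, hx⟩, rfl⟩
    exact ⟨⟨g, rfl⟩, by simpa [Subtype.dist_eq, dist_eq_norm, displacement] using hx⟩

theorem exists_nearlyAdditive_displacement (hH : RigidGroup H) (o : U) :
    ∃ C r, NearlyAdditive (displacement H o) C r := by
  obtain ⟨R, hR, hRU⟩ := Metric.nhds_basis_closedBall.mem_iff.1 (U.isOpen.mem_nhds o.2)
  exact NearlyAdditive.exists_of_eventually (displacement_one o) (hH.isBigO_displacement_mul o)
    (hH.eventually_norm_displacement_inv_le o) hR (hH.isCompact_range_displacement_inter o hRU)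

theorem exists_localParametrization (hH : RigidGroup H) (o : U) :
    ∃ k ≤ Module.finrank ℝ W, Nonempty (LocalParametrization H o (EuclideanSpace ℝ (Fin k))) := by
  obtain ⟨m, hm, hform⟩ := hH.exists_eventually_apply_eq o
  obtain ⟨C, r, ha⟩ := hH.exists_nearlyAdditive_displacement o
  have hc : Tendsto (fun w : W => (w + (o : W), (o : W))) (𝓝 0) (𝓝 ((o : W), (o : W))) :=
    Continuous.tendsto' (by fun_prop) _ _ (by simp)
  have hLs : ∀ᶠ w in 𝓝 (0 : W),
      ContDiffAt ℝ ∞ (fun w => fderiv ℝ m (w + o, (o : W)) ∘L .inr ℝ W W) w := by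
    filter_upwards [hc.eventually hm] with w hw
    exact ((hw.fderiv_right (m := ∞) (by simp)).comp (f := fun w : W => (w + (o : W), (o : W))) w
      (by fun_prop)).clm_comp contDiffAt_const
  have hL0 : fderiv ℝ m ((0 : W) + o, (o : W)) ∘L .inr ℝ W W = .id ℝ W := by
    rw [zero_add]
    refine ((hm.self_of_nhds.differentiableAt (by simp)).hasFDerivAt.comp
      (f := fun y => ((o : W), y)) (o : W) (hasFDerivAt_prodMk_right _ _)).unique ?_
    exact (hasFDerivAt_id _).congr_of_eventuallyEq
      (eventually_eq_of_eventually_apply_eq hform)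
  obtain ⟨k, hk, P, B, δ, γ, hB, h0B, hδ, hγ, hγs, hinj⟩ := ha.exists_contDiffOn_section hLs hL0
    (HasLocalFormula.isLittleO_displacement_mul_sub_sub hform
      (contDiffAt_infty.1 hm.self_of_nhds 1))
  refine ⟨k, hk, ⟨⟨P, B, δ, γ, hB, h0B, hδ, fun z hz => (hγ z hz).1,
    fun z hz => (hγ z hz).2, hγs, fun g hg hgB => ?_⟩⟩⟩
  have hzero : (g⁻¹ * γ (P (displacement H o g))).1 o = (1 : H).1 o :=
    Subtype.ext (sub_eq_zero.1 (hinj g hg hgB))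
  exact (inv_mul_eq_one.1 (hH.eq_of_apply_eq hzero)).symm

end RigidGroup

end

section

open Filter RigidGroup

variable {W : Type*} [NormedAddCommGroup W] [NormedSpace ℝ W] {U : Opens W}
  {H : Subgroup (U ≃ₜ U)} {o : U}

/-- A manifold structure on a transformation group, modelled on `E`, for which the map to the orbit
of `o` is an immersion onto a locally closed submanifold, in the form of local smooth left
inverses. -/
structure IsOrbitManifold (H : Subgroup (U ≃ₜ U)) (o : U) (E : Type*) [NormedAddCommGroup E]
    [NormedSpace ℝ E] [TopologicalSpace H] [ChartedSpace E H] : Prop extends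
    IsManifold 𝓘(ℝ, E) ∞ H where
  isInducing_apply : IsInducing fun g : H => g.1 o
  contMDiff_apply : ContMDiff 𝓘(ℝ, E) 𝓘(ℝ, W) ∞ fun g : H => g.1 o
  exists_leftInverse : ∀ g : H, ∃ π : U → H, ContMDiffAt 𝓘(ℝ, W) 𝓘(ℝ, E) ∞ π (g.1 o) ∧
    ∀ᶠ h in 𝓝 g, π (h.1 o) = h

namespace LocalParametrization

variable {E : Type*} [NormedAddCommGroup E] [NormedSpace ℝ E] (c : LocalParametrization H o E)

theorem contMDiffOn_apply :
    ContMDiffOn 𝓘(ℝ, E) 𝓘(ℝ, W) ∞ (fun z => (c.toFun z).1 o) c.domain := by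
  intro z hz
  rw [← ContMDiffWithinAt.subtypeVal_comp_iff]
  refine (((c.contDiffOn z hz).add (contDiffWithinAt_const (c := (o : W)))).congr
    (fun z _ => ?_) ?_).contMDiffWithinAt <;>
  simp [displacement]

theorem contMDiff_proj_apply_sub (hH : HasLocalFormula H) (g : H) :
    ContMDiff 𝓘(ℝ, W) 𝓘(ℝ, E) ∞ fun x : U => c.proj ((g.1 x : W) - o) := by
  have hproj : ContMDiff 𝓘(ℝ, W) 𝓘(ℝ, E) ∞ fun w : W => c.proj (w - o) :=
    ContDiff.contMDiff (by fun_prop)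
  exact hproj.comp (contMDiff_subtype_val.comp (hH.contMDiff_apply g))

variable [TopologicalSpace H] (ho : IsInducing fun g : H => g.1 o)

/-- The chart at `g` given by a local parametrization of a transformation group near the
identity. -/
noncomputable def chart (g : H) : OpenPartialHomeomorph H E where
  toFun h := c.proj (displacement H o (g⁻¹ * h))
  invFun z := g * c.toFun z
  source := {h | ‖displacement H o (g⁻¹ * h)‖ < c.radius ∧
    c.proj (displacement H o (g⁻¹ * h)) ∈ c.domain}
  target := c.domain
  map_source' _ hh := hh.2
  map_target' z hz := by
    simpa [c.proj_displacement z hz, c.norm_displacement_lt z hz] using hz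
  left_inv' h hh := by simp only [c.toFun_proj _ hh.1 hh.2, mul_inv_cancel_left]
  right_inv' z hz := by simp [c.proj_displacement z hz]
  open_source := by
    have hc : Continuous fun h : H => displacement H o (g⁻¹ * h) :=
      ((continuous_subtype_val.comp (g⁻¹).1.continuous).comp ho.continuous).sub continuous_const
    exact (isOpen_lt hc.norm continuous_const).inter
      (c.isOpen_domain.preimage (c.proj.continuous.comp hc))
  open_target := c.isOpen_domain
  continuousOn_toFun :=
    (c.proj.continuous.comp ((continuous_subtype_val.comp ((g⁻¹).1.continuous.comp
      ho.continuous)).sub continuous_const)).continuousOn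
  continuousOn_invFun := ho.continuousOn_iff.2
    (g.1.continuous.comp_continuousOn c.contMDiffOn_apply.continuousOn)

theorem mem_chart_source (g : H) : g ∈ (c.chart ho g).source := by
  simp [chart, displacement, c.radius_pos, c.zero_mem_domain]

/-- The charts given by the left translates of a local parametrization of a transformation
group. -/
@[reducible]
noncomputable def chartedSpace : ChartedSpace E H where
  atlas := range (c.chart ho)
  chartAt := c.chart ho
  mem_chart_source := c.mem_chart_source ho
  chart_mem_atlas := mem_range_self

theorem isManifold (hH : HasLocalFormula H) :
    @IsManifold ℝ _ E _ _ E _ 𝓘(ℝ, E) ∞ H _ (c.chartedSpace ho) := by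
  let _ := c.chartedSpace ho
  refine isManifold_of_contDiffOn _ _ _ ?_
  rintro _ _ ⟨g, rfl⟩ ⟨g', rfl⟩
  have htrans := (c.contMDiff_proj_apply_sub hH (g'⁻¹ * g)).comp_contMDiffOn c.contMDiffOn_apply
  refine (contMDiffOn_iff_contDiffOn.1 htrans).mono ?_ |>.congr ?_
  · rintro z ⟨hz, -⟩
    exact hz.1
  · simp [chart, displacement]

theorem isOrbitManifold (hH : HasLocalFormula H) :
    @IsOrbitManifold W _ _ U H o E _ _ _ (c.chartedSpace ho) := by
  let _ := c.chartedSpace ho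
  have hman := c.isManifold ho hH
  have hchart (g : H) : c.chart ho g ∈ IsManifold.maximalAtlas 𝓘(ℝ, E) ∞ H :=
    IsManifold.subset_maximalAtlas ⟨g, rfl⟩
  have hleft (g : H) : ∀ᶠ h in 𝓝 g, (c.chart ho g).symm (c.chart ho g h) = h := by
    filter_upwards [(c.chart ho g).open_source.mem_nhds (c.mem_chart_source ho g)] with h hh
    exact (c.chart ho g).left_inv hh
  refine ⟨hman, ho, fun g => ?_, fun g => ?_⟩
  · have horbit : ContMDiffAt 𝓘(ℝ, E) 𝓘(ℝ, W) ∞ (fun z => g.1 ((c.toFun z).1 o))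
        (c.chart ho g g) :=
      (hH.contMDiff_apply g _).comp _ (c.contMDiffOn_apply.contMDiffAt
        (c.isOpen_domain.mem_nhds ((c.chart ho g).map_source (c.mem_chart_source ho g))))
    refine (horbit.comp g (contMDiffAt_of_mem_maximalAtlas (hchart g)
      (c.mem_chart_source ho g))).congr_of_eventuallyEq ?_
    filter_upwards [hleft g] with h hh
    exact congrArg (fun h : H => h.1 o) hh.symm
  · exact ⟨fun x => (c.chart ho g).symm (c.proj (((g⁻¹).1 x : W) - o)),
      (contMDiffAt_symm_of_mem_maximalAtlas (hchart g)
        ((c.chart ho g).map_source (c.mem_chart_source ho g))).comp (g.1 o)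
        (c.contMDiff_proj_apply_sub hH g⁻¹ (g.1 o)), hleft g⟩

end LocalParametrization

variable {E : Type*} [NormedAddCommGroup E] [NormedSpace ℝ E] [TopologicalSpace H]
  [ChartedSpace E H]

namespace HasLocalFormula

/- Since `h ↦ h x` is smooth at `g`, so is `(h, y) ↦ h y = F (x, h x, y)`. -/
theorem contMDiffAt_action_of_apply {x y : U} {g : H} {F : W × W × W → W}
    (hF : ContDiffAt ℝ ∞ F (x, g.1 x, y))
    (hform : ∀ᶠ z : U × U × U in 𝓝 (x, g.1 x, y), ∀ h ∈ H, h z.1 = z.2.1 →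
      (h z.2.2 : W) = F (z.1, z.2.1, z.2.2))
    (hx : ContMDiffAt 𝓘(ℝ, E) 𝓘(ℝ, W) ∞ (fun h : H => h.1 x) g) :
    ContMDiffAt (𝓘(ℝ, E).prod 𝓘(ℝ, W)) 𝓘(ℝ, W) ∞ (fun z : H × U => z.1.1 z.2) (g, y) := by
  rw [← ContMDiffAt.subtypeVal_comp_iff]
  have hx' : ContMDiffAt (𝓘(ℝ, E).prod 𝓘(ℝ, W)) 𝓘(ℝ, W) ∞ (fun z : H × U => z.1.1 x) (g, y) :=
    hx.comp (g, y) contMDiffAt_fst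
  have hc : ContMDiffAt (𝓘(ℝ, E).prod 𝓘(ℝ, W)) 𝓘(ℝ, W × W × W) ∞
      (fun z : H × U => ((x : W), (z.1.1 x : W), (z.2 : W))) (g, y) :=
    contMDiffAt_const.prodMk_space (((contMDiff_subtype_val _).comp (g, y) hx').prodMk_space
      ((contMDiff_subtype_val _).comp (g, y) contMDiffAt_snd))
  refine (ContMDiffAt.comp (g := F) (g, y) hF.contMDiffAt hc).congr_of_eventuallyEq ?_
  have hlim : Tendsto (fun z : H × U => (x, z.1.1 x, z.2)) (𝓝 (g, y)) (𝓝 (x, g.1 x, y)) :=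
    tendsto_const_nhds.prodMk_nhds (hx'.continuousAt.tendsto.prodMk_nhds
      (continuous_snd.tendsto (g, y)))
  filter_upwards [hlim.eventually hform] with z hz
  exact hz z.1.1 z.1.2 rfl

theorem eventually_contMDiffAt_action (hH : HasLocalFormula H) (g : H) (q : U) :
    ∀ᶠ z : U × U in 𝓝 (q, q), ContMDiffAt 𝓘(ℝ, E) 𝓘(ℝ, W) ∞ (fun h : H => h.1 z.1) g →
      ContMDiffAt (𝓘(ℝ, E).prod 𝓘(ℝ, W)) 𝓘(ℝ, W) ∞ (fun z : H × U => z.1.1 z.2) (g, z.2) := by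
  obtain ⟨F, hF, -, hform⟩ := hH.exists_formula q (g.1 q)
  have hcU : Continuous fun z : U × U => (z.1, g.1 z.1, z.2) :=
    continuous_fst.prodMk ((g.1.continuous.comp continuous_fst).prodMk continuous_snd)
  have hcW : Continuous fun z : U × U => ((z.1 : W), (g.1 z.1 : W), (z.2 : W)) :=
    (by fun_prop : Continuous fun z : U × U × U => ((z.1 : W), (z.2.1 : W), (z.2.2 : W))).comp hcU
  filter_upwards [(hcW.tendsto (q, q)).eventually hF,
    (hcU.tendsto (q, q)).eventually hform.eventually_nhds] with z hz hform
  exact contMDiffAt_action_of_apply hz hform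

end HasLocalFormula

namespace IsOrbitManifold

theorem contMDiffAt_of_apply (hM : IsOrbitManifold H o E) {E' H' M : Type*}
    [NormedAddCommGroup E'] [NormedSpace ℝ E'] [TopologicalSpace H'] {I : ModelWithCorners ℝ E' H'}
    [TopologicalSpace M] [ChartedSpace H' M] {F : M → H} {x : M}
    (hF : ContMDiffAt I 𝓘(ℝ, W) ∞ (fun y => (F y).1 o) x) : ContMDiffAt I 𝓘(ℝ, E) ∞ F x := by
  obtain ⟨π, hπ, hleft⟩ := hM.exists_leftInverse (F x)
  have hcont : ContinuousAt F x := hM.isInducing_apply.continuousAt_iff.2 hF.continuousAt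
  refine (hπ.comp x hF).congr_of_eventuallyEq ?_
  filter_upwards [hcont.eventually hleft] with y hy
  exact hy.symm

variable [PreconnectedSpace U]

theorem contMDiff_action (hM : IsOrbitManifold H o E) (hH : HasLocalFormula H) :
    ContMDiff (𝓘(ℝ, E).prod 𝓘(ℝ, W)) 𝓘(ℝ, W) ∞ (fun z : H × U => z.1.1 z.2) := by
  rintro ⟨g, q⟩
  have happly (x : U) (hx : ContMDiffAt (𝓘(ℝ, E).prod 𝓘(ℝ, W)) 𝓘(ℝ, W) ∞
      (fun z : H × U => z.1.1 z.2) (g, x)) :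
      ContMDiffAt 𝓘(ℝ, E) 𝓘(ℝ, W) ∞ (fun h : H => h.1 x) g :=
    ContMDiffAt.comp (g := fun z : H × U => z.1.1 z.2) (f := fun h : H => (h, x)) g hx
      (contMDiffAt_id.prodMk contMDiffAt_const)
  have hclopen : IsClopen {x : U | ContMDiffAt (𝓘(ℝ, E).prod 𝓘(ℝ, W)) 𝓘(ℝ, W) ∞
      (fun z : H × U => z.1.1 z.2) (g, x)} := by
    refine ⟨isClosed_iff_frequently.2 fun x hx => ?_, isOpen_iff_eventually.2 fun x hx => ?_⟩
    · have hc : Tendsto (fun y : U => (y, x)) (𝓝 x) (𝓝 (x, x)) :=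
        Continuous.tendsto' (by fun_prop) _ _ rfl
      obtain ⟨y, hy, hyx⟩ :=
        (hx.and_eventually (hc.eventually (hH.eventually_contMDiffAt_action (E := E) g x))).exists
      exact hyx (happly y hy)
    · have hc : Tendsto (fun y : U => (x, y)) (𝓝 x) (𝓝 (x, x)) :=
        Continuous.tendsto' (by fun_prop) _ _ rfl
      filter_upwards [hc.eventually (hH.eventually_contMDiffAt_action (E := E) g x)] with y hy
      exact hy (happly x hx)
  have ho := (hH.eventually_contMDiffAt_action (E := E) g o).self_of_nhds (hM.contMDiff_apply g)
  exact eq_univ_iff_forall.1 (hclopen.eq_univ ⟨o, ho⟩) q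

theorem contMDiff_inv (hM : IsOrbitManifold H o E) (hH : HasLocalFormula H) :
    ContMDiff 𝓘(ℝ, E) 𝓘(ℝ, E) ∞ fun g : H => g⁻¹ := by
  intro g
  refine hM.contMDiffAt_of_apply ?_
  rw [← ContMDiffAt.subtypeVal_comp_iff]
  set p : U := (g⁻¹).1 o
  have hp : g.1 p = o := g.1.apply_symm_apply o
  obtain ⟨F, hF, -, hform⟩ := hH.exists_formula o p
  have hsmooth : ContMDiffAt 𝓘(ℝ, E) 𝓘(ℝ, W) ∞ (fun h : H => h.1 p) g :=
    ContMDiffAt.comp (g := fun z : H × U => z.1.1 z.2) (f := fun h : H => (h, p)) g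
      (hM.contMDiff_action hH _) (contMDiffAt_id.prodMk contMDiffAt_const)
  have hc : ContMDiffAt 𝓘(ℝ, E) 𝓘(ℝ, W × W × W) ∞
      (fun h : H => ((h.1 p : W), (p : W), (o : W))) g :=
    ((contMDiff_subtype_val _).comp g hsmooth).prodMk_space contMDiffAt_const
  refine (ContMDiffAt.comp (g := F) g (by simpa [hp] using hF.self_of_nhds.contMDiffAt)
    hc).congr_of_eventuallyEq ?_
  have hlim : Tendsto (fun h : H => (h.1 p, p, o)) (𝓝 g) (𝓝 (o, p, o)) :=
    (hp ▸ hsmooth.continuousAt.tendsto).prodMk_nhds tendsto_const_nhds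
  filter_upwards [hlim.eventually hform] with h hh
  exact hh (h⁻¹).1 (h⁻¹).2 (h.1.symm_apply_apply p)

theorem lieGroup (hM : IsOrbitManifold H o E) (hH : HasLocalFormula H) :
    LieGroup 𝓘(ℝ, E) ∞ H :=
  { hM.toIsManifold with
    contMDiff_mul := fun z => hM.contMDiffAt_of_apply
      (ContMDiffAt.comp (g := fun z : H × U => z.1.1 z.2) z (hM.contMDiff_action hH _)
        (contMDiffAt_fst.prodMk ((hM.contMDiff_apply z.2).comp z contMDiffAt_snd)))
    contMDiff_inv := hM.contMDiff_inv hH }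

end IsOrbitManifold

theorem RigidGroup.exists_lieGroup [FiniteDimensional ℝ W] [PreconnectedSpace U]
    (hH : RigidGroup H)
    (hτ : IsInducing fun g : H => (⟨g.1, g.1.continuous⟩ : C(U, U))) (o : U) :
    ∃ k ≤ Module.finrank ℝ W, ∃ _ : ChartedSpace (EuclideanSpace ℝ (Fin k)) H,
      LieGroup (𝓡 k) ∞ H ∧
      ContMDiff ((𝓡 k).prod 𝓘(ℝ, W)) 𝓘(ℝ, W) ∞ (fun z : H × U => z.1.1 z.2) := by
  obtain ⟨k, hk, ⟨c⟩⟩ := hH.exists_localParametrization o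
  have ho := (hH.isEmbedding_apply hτ o).isInducing
  let _ := c.chartedSpace ho
  have hM := c.isOrbitManifold ho hH.toHasLocalFormula
  exact ⟨k, hk, inferInstance, hM.lieGroup hH.toHasLocalFormula,
    hM.contMDiff_action hH.toHasLocalFormula⟩

end

/-! ### Smooth dependence of integrals on parameters -/

section

open Filter MeasureTheory

theorem eventually_forall_uIcc {X : Type*} [TopologicalSpace X] {P : X × ℝ → Prop} {x₀ : X}
    {u₀ : ℝ} (hP : ∀ᶠ z in 𝓝 (x₀, u₀), P z) :
    ∀ᶠ w : X × ℝ × ℝ in 𝓝 (x₀, u₀, u₀), ∀ u ∈ uIcc w.2.1 w.2.2, P (w.1, u) := by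
  obtain ⟨V, hV, T, hT, hVT⟩ := eventually_prod_iff.1 (nhds_prod_eq (x := x₀) (y := u₀) ▸ hP)
  have hu : Tendsto (fun w : X × ℝ × ℝ => uIcc w.2.1 w.2.2) (𝓝 (x₀, u₀, u₀))
      (𝓝 u₀).smallSets :=
    Tendsto.uIcc (Continuous.tendsto' (by fun_prop) _ _ rfl)
      (Continuous.tendsto' (by fun_prop) _ _ rfl)
  filter_upwards [continuous_fst.continuousAt.eventually hV, hu.eventually (hT.smallSets)]
    with w hw hw' u hu
  exact hVT hw (hw' u hu)

theorem exists_eventually_norm_le {X Y F : Type*} [TopologicalSpace X] [TopologicalSpace Y]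
    [SeminormedAddCommGroup F] {K : Set Y} (hK : IsCompact K) {G : X × Y → F} {x₀ : X}
    (hG : ∀ y ∈ K, ContinuousAt G (x₀, y)) : ∃ M, ∀ᶠ x in 𝓝 x₀, ∀ y ∈ K, ‖G (x, y)‖ ≤ M := by
  have hcont : ContinuousOn (fun y => ‖G (x₀, y)‖) K := fun y hy =>
    (ContinuousAt.comp (g := fun z => ‖G z‖) (f := fun y => (x₀, y)) (hG y hy).norm
      (by fun_prop)).continuousWithinAt
  obtain ⟨M, hM⟩ := (hK.image_of_continuousOn hcont).bddAbove
  refine ⟨M + 1, hK.eventually_forall_of_forall_eventually fun y hy => ?_⟩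
  filter_upwards [(hG y hy).norm.eventually_lt_const
    ((hM (mem_image_of_mem _ hy)).trans_lt (lt_add_one M))] with z hz
  exact hz.le

universe u

variable {X F : Type u} [NormedAddCommGroup X] [NormedSpace ℝ X] [NormedAddCommGroup F]
  [NormedSpace ℝ F]

theorem continuousOn_prodMk_of_contDiffAt {n : WithTop ℕ∞} {G : X × ℝ → F} {x : X} {K : Set ℝ}
    (hG : ∀ θ ∈ K, ContDiffAt ℝ n G (x, θ)) : ContinuousOn (fun θ => G (x, θ)) K := fun θ hθ =>
  (ContinuousAt.comp (g := G) (f := fun θ => (x, θ)) (hG θ hθ).continuousAt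
    (by fun_prop)).continuousWithinAt

theorem hasFDerivAt_intervalIntegral_of_contDiffAt {G : X × ℝ → F} {x₀ : X} {a b : ℝ}
    (hG : ∀ θ ∈ uIcc a b, ContDiffAt ℝ 1 G (x₀, θ)) :
    HasFDerivAt (fun x => ∫ θ in a..b, G (x, θ))
      (∫ θ in a..b, fderiv ℝ G (x₀, θ) ∘L .inl ℝ X ℝ) x₀ := by
  have hD (θ) (hθ : θ ∈ uIcc a b) :
      ContDiffAt ℝ 0 (fun z => fderiv ℝ G z ∘L .inl ℝ X ℝ) (x₀, θ) :=
    ((hG θ hθ).fderiv_right (by simp)).clm_comp contDiffAt_const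
  have hev : ∀ᶠ x in 𝓝 x₀, ∀ θ ∈ uIcc a b, ContDiffAt ℝ 1 G (x, θ) :=
    isCompact_uIcc.eventually_forall_of_forall_eventually fun θ hθ =>
      (hG θ hθ).eventually (by simp)
  obtain ⟨M, hM⟩ := exists_eventually_norm_le isCompact_uIcc fun θ hθ => (hD θ hθ).continuousAt
  refine intervalIntegral.hasFDerivAt_integral_of_dominated_of_fderiv_le
    (F' := fun x θ => fderiv ℝ G (x, θ) ∘L .inl ℝ X ℝ) (bound := fun _ => M) (hev.and hM)
    ?_ (continuousOn_prodMk_of_contDiffAt hG).intervalIntegrable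
    (((continuousOn_prodMk_of_contDiffAt hD).aestronglyMeasurable measurableSet_uIcc).mono_set
      uIoc_subset_uIcc)
    (ae_of_all _ fun θ hθ x hx => hx.2 θ (uIoc_subset_uIcc hθ)) intervalIntegrable_const
    (ae_of_all _ fun θ hθ x hx => ?_)
  · filter_upwards [hev] with x hx
    exact ((continuousOn_prodMk_of_contDiffAt hx).aestronglyMeasurable
      measurableSet_uIcc).mono_set uIoc_subset_uIcc
  · exact HasFDerivAt.comp (f := fun x => (x, θ)) x
      ((hx.1 θ (uIoc_subset_uIcc hθ)).differentiableAt (by simp)).hasFDerivAt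
      (hasFDerivAt_prodMk_left x θ)

theorem eventually_hasFDerivAt_intervalIntegral {G : X × ℝ → F} {x₀ : X} {a b : ℝ}
    (hG : ∀ θ ∈ uIcc a b, ContDiffAt ℝ 1 G (x₀, θ)) :
    ∀ᶠ x in 𝓝 x₀, HasFDerivAt (fun x => ∫ θ in a..b, G (x, θ))
      (∫ θ in a..b, fderiv ℝ G (x, θ) ∘L .inl ℝ X ℝ) x := by
  have hev : ∀ᶠ x in 𝓝 x₀, ∀ θ ∈ uIcc a b, ContDiffAt ℝ 1 G (x, θ) :=
    isCompact_uIcc.eventually_forall_of_forall_eventually fun θ hθ =>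
      (hG θ hθ).eventually (by simp)
  exact hev.mono fun x hx => hasFDerivAt_intervalIntegral_of_contDiffAt hx

theorem contDiffAt_intervalIntegral {G : X × ℝ → F} {x₀ : X} {a b : ℝ}
    (hG : ∀ θ ∈ uIcc a b, ContDiffAt ℝ ∞ G (x₀, θ)) :
    ContDiffAt ℝ ∞ (fun x => ∫ θ in a..b, G (x, θ)) x₀ := by
  rw [contDiffAt_infty]
  intro n
  induction n generalizing F with
  | zero =>
    exact contDiffAt_zero.2 ⟨_, eventually_hasFDerivAt_intervalIntegral fun θ hθ =>
      contDiffAt_infty.1 (hG θ hθ) 1, fun x (hx : HasFDerivAt _ _ x) =>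
        hx.continuousAt.continuousWithinAt⟩
  | succ n ih =>
    refine contDiffAt_succ_iff_hasFDerivAt.2 ⟨_, ⟨_, eventually_hasFDerivAt_intervalIntegral
      fun θ hθ => contDiffAt_infty.1 (hG θ hθ) 1, fun x hx => hx⟩, ih
      (G := fun z => fderiv ℝ G z ∘L .inl ℝ X ℝ) fun θ hθ => ?_⟩
    exact ((hG θ hθ).fderiv_right (by simp)).clm_comp contDiffAt_const

theorem contDiffAt_intervalIntegral_endpoints {g : X × ℝ → F} {x₀ : X} {a b : ℝ}
    (hg : ∀ u ∈ uIcc a b, ContDiffAt ℝ ∞ g (x₀, u)) :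
    ContDiffAt ℝ ∞ (fun w : X × ℝ × ℝ => ∫ u in w.2.1..w.2.2, g (w.1, u)) (x₀, a, b) := by
  have heq : (fun w : X × ℝ × ℝ => ∫ u in w.2.1..w.2.2, g (w.1, u)) = fun w =>
      (w.2.2 - w.2.1) • ∫ θ in (0 : ℝ)..1, g (w.1, w.2.1 + (w.2.2 - w.2.1) * θ) := by
    funext w
    simp [intervalIntegral.smul_integral_comp_add_mul (fun u => g (w.1, u))]
  rw [heq]
  refine ContDiffAt.smul (by fun_prop) (contDiffAt_intervalIntegral
    (G := fun z : (X × ℝ × ℝ) × ℝ => g (z.1.1, z.1.2.1 + (z.1.2.2 - z.1.2.1) * z.2))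
    fun θ hθ => ?_)
  have hmem : a + (b - a) * θ ∈ uIcc a b := by
    rw [uIcc_of_le zero_le_one] at hθ
    rw [← segment_eq_uIcc, segment_eq_image']
    exact ⟨θ, hθ, by simp [mul_comm]⟩
  exact ContDiffAt.comp (g := g)
    (f := fun z : (X × ℝ × ℝ) × ℝ => (z.1.1, z.1.2.1 + (z.1.2.2 - z.1.2.1) * z.2)) _ (hg _ hmem)
    (by fun_prop)

end

/-! ### Separable differential equations depending on parameters -/

section

open Filter

theorem eventually_contDiffAt_implicitFunction {𝕜 : Type*} [RCLike 𝕜] {E₁ E₂ F : Type*}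
    [NormedAddCommGroup E₁] [NormedSpace 𝕜 E₁] [CompleteSpace E₁]
    [NormedAddCommGroup E₂] [NormedSpace 𝕜 E₂] [CompleteSpace E₂]
    [NormedAddCommGroup F] [NormedSpace 𝕜 F] [CompleteSpace F] {f : E₁ × E₂ → F} {p : E₁ × E₂}
    (hf : ∀ᶠ z in 𝓝 p, ContDiffAt 𝕜 ∞ f z) (hinv : (fderiv 𝕜 f p ∘L .inr 𝕜 E₁ E₂).IsInvertible) :
    ∀ᶠ x in 𝓝 p.1, ContDiffAt 𝕜 ∞ (hf.self_of_nhds.implicitFunction (by simp) hinv) x := by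
  set S := hf.self_of_nhds.implicitFunction (by simp) hinv
  have hS : ContDiffAt 𝕜 ∞ S p.1 := ContDiffAt.contDiffAt_implicitFunction ..
  have hSp : S p.1 = p.2 := ContDiffAt.implicitFunction_apply_self ..
  have hlim : Tendsto (fun x => (x, S x)) (𝓝 p.1) (𝓝 p) := by
    have := (continuousAt_id.prodMk hS.continuousAt).tendsto
    rwa [id, hSp] at this
  have hinv' : ∀ᶠ z in 𝓝 p, (fderiv 𝕜 f z ∘L .inr 𝕜 E₁ E₂).IsInvertible := by
    have hc : ContinuousAt (fun z => fderiv 𝕜 f z ∘L .inr 𝕜 E₁ E₂) p :=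
      ((hf.self_of_nhds.fderiv_right (m := ∞) (by simp)).clm_comp contDiffAt_const).continuousAt
    exact hc.eventually ((ContinuousLinearEquiv.isOpen (𝕜 := 𝕜)).eventually_mem hinv)
  have heq : ∀ᶠ x in 𝓝 p.1, f (x, S x) = f p := ContDiffAt.eventually_apply_implicitFunction ..
  filter_upwards [hlim.eventually hf, hlim.eventually hinv',
    (contDiffAt_infty.1 hS 1).eventually (by simp), heq.eventually_nhds] with x hfx hix hSx heqx
  refine (hfx.contDiffAt_implicitFunction (by simp) hix).congr_of_eventuallyEq ?_
  filter_upwards [heqx, (continuousAt_id.prodMk hSx.continuousAt).eventually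
    (hfx.eventually_apply_eq_iff_implicitFunction (by simp) hix)] with y hy hy'
  exact (hy'.1 (hy.trans heqx.self_of_nhds.symm)).symm

theorem norm_sub_le_of_norm_deriv_le_of_norm_sub_le {E : Type*} [NormedAddCommGroup E]
    [NormedSpace ℝ E] {ψ ψ' : ℝ → E} {u₀ u₁ η M : ℝ} (hη : 0 < η) (hM : M * |u₁ - u₀| < η)
    (hψ : ∀ u ∈ uIcc u₀ u₁, HasDerivAt ψ (ψ' u) u)
    (hψ' : ∀ u ∈ uIcc u₀ u₁, ‖ψ u - ψ u₀‖ ≤ η → ‖ψ' u‖ ≤ M) :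
    ∀ u ∈ uIcc u₀ u₁, ‖ψ u - ψ u₀‖ ≤ η := by
  set p : ℝ → ℝ := fun θ => u₀ + θ * (u₁ - u₀) with hp
  have hp0 : p 0 = u₀ := by simp [hp]
  have huIcc : uIcc u₀ u₁ = p '' Icc 0 1 := by
    rw [← segment_eq_uIcc, segment_eq_image']
    simp only [smul_eq_mul, hp]
  have hpd (θ : ℝ) : HasDerivAt p (u₁ - u₀) θ := by
    have := ((hasDerivAt_id θ).mul_const (u₁ - u₀)).const_add u₀
    rwa [one_mul] at this
  have hmem (θ : ℝ) (hθ : θ ∈ Icc 0 1) : p θ ∈ uIcc u₀ u₁ := huIcc ▸ mem_image_of_mem p hθ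
  have hder (θ : ℝ) (hθ : θ ∈ Icc 0 1) :
      HasDerivAt (fun θ => ψ (p θ) - ψ u₀) ((u₁ - u₀) • ψ' (p θ)) θ :=
    ((hψ _ (hmem θ hθ)).scomp θ (hpd θ)).sub_const _
  have hbound : ∀ θ ∈ Icc (0 : ℝ) 1, ‖ψ (p θ) - ψ u₀‖ ≤ η * θ := by
    refine fun θ hθ => image_norm_le_of_norm_deriv_right_lt_deriv_boundary'
      (f := fun θ => ψ (p θ) - ψ u₀) (B := fun θ => η * θ) (B' := fun _ => η)
      (fun θ hθ => (hder θ hθ).continuousAt.continuousWithinAt)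
      (fun θ hθ => (hder θ (Ico_subset_Icc_self hθ)).hasDerivWithinAt)
      (by simp [hp0]) (by fun_prop)
      (fun θ _ => by simpa using ((hasDerivAt_id θ).const_mul η).hasDerivWithinAt)
      (fun θ hθ hθe => ?_) hθ
    have hle : ‖ψ' (p θ)‖ ≤ M :=
      hψ' _ (hmem θ (Ico_subset_Icc_self hθ)) (hθe.le.trans (by nlinarith [hθ.2]))
    calc ‖(u₁ - u₀) • ψ' (p θ)‖ = ‖ψ' (p θ)‖ * |u₁ - u₀| := by
          rw [norm_smul, Real.norm_eq_abs, mul_comm]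
      _ ≤ M * |u₁ - u₀| := by gcongr
      _ < η := hM
  rw [huIcc]
  rintro _ ⟨θ, hθ, rfl⟩
  exact (hbound θ hθ).trans (by nlinarith [hθ.2])

theorem eventually_solution_mem_of_continuousAt {P E : Type*} [TopologicalSpace P]
    [NormedAddCommGroup E] [NormedSpace ℝ E] {F : P × ℝ × E → E} {p₀ : P} {u₀ : ℝ} {s₀ : E}
    (hF : ContinuousAt F (p₀, u₀, s₀)) {V : Set E} (hV : V ∈ 𝓝 s₀) :
    ∀ᶠ w : P × E × ℝ × ℝ in 𝓝 (p₀, s₀, u₀, u₀), ∀ ψ : ℝ → E, ψ w.2.2.1 = w.2.1 →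
      (∀ v ∈ uIcc w.2.2.1 w.2.2.2, HasDerivAt ψ (F (w.1, v, ψ v)) v) →
      ∀ v ∈ uIcc w.2.2.1 w.2.2.2, ψ v ∈ V := by
  set M : ℝ := ‖F (p₀, u₀, s₀)‖ + 1
  have hbound : ∀ᶠ z : (P × E) × ℝ in 𝓝 ((p₀, s₀), u₀), ‖F (z.1.1, z.2, z.1.2)‖ ≤ M := by
    have hc : Tendsto (fun z : (P × E) × ℝ => (z.1.1, z.2, z.1.2)) (𝓝 ((p₀, s₀), u₀))
      (𝓝 (p₀, u₀, s₀)) := Continuous.tendsto' (by fun_prop) _ _ rfl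
    filter_upwards [hc.eventually (hF.norm.eventually_lt_const (lt_add_one _))] with z hz
    exact hz.le
  have hc : Tendsto (fun z : (P × E × ℝ × ℝ) × E => ((z.1.1, z.2), z.1.2.2))
      (𝓝 ((p₀, s₀, u₀, u₀), s₀)) (𝓝 ((p₀, s₀), u₀, u₀)) :=
    Continuous.tendsto' (by fun_prop) _ _ rfl
  obtain ⟨T, hT, R, hR, hTR⟩ := eventually_prod_iff.1
    (nhds_prod_eq (x := (p₀, s₀, u₀, u₀)) (y := s₀) ▸
      hc.eventually (eventually_forall_uIcc hbound))
  obtain ⟨ε, hε, hball⟩ := Metric.mem_nhds_iff.1 (inter_mem hR hV)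
  have hs : Tendsto (fun w : P × E × ℝ × ℝ => ‖w.2.1 - s₀‖) (𝓝 (p₀, s₀, u₀, u₀)) (𝓝 0) :=
    Continuous.tendsto' (by fun_prop) _ _ (by simp)
  have hM : Tendsto (fun w : P × E × ℝ × ℝ => M * |w.2.2.2 - w.2.2.1|) (𝓝 (p₀, s₀, u₀, u₀))
      (𝓝 0) := Continuous.tendsto' (by fun_prop) _ _ (by simp)
  filter_upwards [hT, hs.eventually_lt_const (half_pos hε), hM.eventually_lt_const (half_pos hε)]
    with w hTw hsw hMw ψ hψw hψ v hv
  have hmem {s : E} (hs : ‖s - ψ w.2.2.1‖ ≤ ε / 2) : s ∈ {s | R s} ∩ V := by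
    refine hball (mem_ball_iff_norm.2 ?_)
    calc ‖s - s₀‖ ≤ ‖s - ψ w.2.2.1‖ + ‖ψ w.2.2.1 - s₀‖ := norm_sub_le_norm_sub_add_norm_sub ..
      _ < ε := by rw [hψw] at hs ⊢; linarith
  exact (hmem (norm_sub_le_of_norm_deriv_le_of_norm_sub_le (half_pos hε) hMw hψ
    (fun u hu hle => hTR hTw (hmem hle).1 u hu) v hv)).2

theorem integral_inv_eq_integral_of_hasDerivAt_mul {A B ψ : ℝ → ℝ} {u₀ u₁ : ℝ}
    (hψ : ∀ u ∈ uIcc u₀ u₁, HasDerivAt ψ (A (ψ u) * B u) u)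
    (hA : ContinuousOn A (ψ '' uIcc u₀ u₁)) (hA0 : ∀ u ∈ uIcc u₀ u₁, A (ψ u) ≠ 0)
    (hB : ContinuousOn B (uIcc u₀ u₁)) :
    ∫ s in ψ u₀..ψ u₁, (A s)⁻¹ = ∫ u in u₀..u₁, B u := by
  have hψc : ContinuousOn ψ (uIcc u₀ u₁) := fun u hu => (hψ u hu).continuousAt.continuousWithinAt
  have hsubst : ∫ u in u₀..u₁, (A (ψ u))⁻¹ * (A (ψ u) * B u) = ∫ s in ψ u₀..ψ u₁, (A s)⁻¹ :=
    intervalIntegral.integral_comp_mul_deriv' hψ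
      ((hA.comp hψc fun u hu => mem_image_of_mem ψ hu).mul hB)
      (hA.inv₀ (by rintro _ ⟨u, hu, rfl⟩; exact hA0 u hu))
  rw [← hsubst]
  exact intervalIntegral.integral_congr fun u hu => inv_mul_cancel_left₀ (hA0 u hu) (B u)

/-- The left-hand side of the implicit equation `∫ₛ^{s'} dσ / A(p, σ) - ∫ᵤ^{u'} B(p, v) dv = 0` for
the value `s'` at `u'` of the solution of `ψ' = A(p, ψ) B(p, u)` with `ψ(u) = s`; the argument is
`((p, s, u, u'), s')`. -/
noncomputable def separableDefect {P : Type*} (A B : P × ℝ → ℝ) (z : (P × ℝ × ℝ × ℝ) × ℝ) : ℝ :=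
  (∫ s in z.1.2.1..z.2, (A (z.1.1, s))⁻¹) - ∫ u in z.1.2.2.1..z.1.2.2.2, B (z.1.1, u)

theorem separableDefect_eq_zero {P : Type*} [TopologicalSpace P] {A B : P × ℝ → ℝ} {p : P}
    {u u' : ℝ} {ψ : ℝ → ℝ}
    (hψ : ∀ v ∈ uIcc u u', HasDerivAt ψ (A (p, ψ v) * B (p, v)) v)
    (hA : ∀ v ∈ uIcc u u', ContinuousAt A (p, ψ v)) (hA0 : ∀ v ∈ uIcc u u', A (p, ψ v) ≠ 0)
    (hB : ∀ v ∈ uIcc u u', ContinuousAt B (p, v)) :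
    separableDefect A B ((p, ψ u, u, u'), ψ u') = 0 := by
  refine sub_eq_zero.2 (integral_inv_eq_integral_of_hasDerivAt_mul (A := fun s => A (p, s))
    (B := fun v => B (p, v)) hψ ?_ hA0 fun v hv => ?_)
  · rintro _ ⟨v, hv, rfl⟩
    exact (ContinuousAt.comp (g := A) (f := fun s => (p, s)) (hA v hv)
      (by fun_prop)).continuousWithinAt
  · exact (ContinuousAt.comp (g := B) (f := fun v => (p, v)) (hB v hv)
      (by fun_prop)).continuousWithinAt

variable {P : Type} [NormedAddCommGroup P] [NormedSpace ℝ P] {A B : P × ℝ → ℝ} {p₀ : P}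
  {s₀ u₀ : ℝ}

theorem eventually_contDiffAt_separableDefect
    (hA : ∀ᶠ z in 𝓝 (p₀, s₀), ContDiffAt ℝ ∞ A z) (hA0 : A (p₀, s₀) ≠ 0)
    (hB : ∀ᶠ z in 𝓝 (p₀, u₀), ContDiffAt ℝ ∞ B z) :
    ∀ᶠ z in 𝓝 ((p₀, s₀, u₀, u₀), s₀), ContDiffAt ℝ ∞ (separableDefect A B) z := by
  have hA' : ∀ᶠ z in 𝓝 (p₀, s₀), ContDiffAt ℝ ∞ (fun z => (A z)⁻¹) z := by
    filter_upwards [hA, hA.self_of_nhds.continuousAt.eventually_ne hA0] with z hz hz0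
    exact hz.inv hz0
  have hs : Tendsto (fun z : (P × ℝ × ℝ × ℝ) × ℝ => (z.1.1, z.1.2.1, z.2))
      (𝓝 ((p₀, s₀, u₀, u₀), s₀)) (𝓝 (p₀, s₀, s₀)) := Continuous.tendsto' (by fun_prop) _ _ rfl
  have hu : Tendsto (fun z : (P × ℝ × ℝ × ℝ) × ℝ => (z.1.1, z.1.2.2))
      (𝓝 ((p₀, s₀, u₀, u₀), s₀)) (𝓝 (p₀, u₀, u₀)) := Continuous.tendsto' (by fun_prop) _ _ rfl
  filter_upwards [hs.eventually (eventually_forall_uIcc hA'),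
    hu.eventually (eventually_forall_uIcc hB)] with z hzA hzB
  exact (ContDiffAt.comp (f := fun z : (P × ℝ × ℝ × ℝ) × ℝ => (z.1.1, z.1.2.1, z.2)) z
    (contDiffAt_intervalIntegral_endpoints hzA) (by fun_prop)).sub
    (ContDiffAt.comp (f := fun z : (P × ℝ × ℝ × ℝ) × ℝ => (z.1.1, z.1.2.2)) z
      (contDiffAt_intervalIntegral_endpoints hzB) (by fun_prop))

theorem isInvertible_fderiv_separableDefect (hA : ∀ᶠ z in 𝓝 (p₀, s₀), ContDiffAt ℝ ∞ A z)
    (hA0 : A (p₀, s₀) ≠ 0) (hB : ∀ᶠ z in 𝓝 (p₀, u₀), ContDiffAt ℝ ∞ B z) :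
    (fderiv ℝ (separableDefect A B) ((p₀, s₀, u₀, u₀), s₀) ∘L
      .inr ℝ (P × ℝ × ℝ × ℝ) ℝ).IsInvertible := by
  have hcont : ∀ᶠ s in 𝓝 s₀, ContinuousAt (fun s => (A (p₀, s))⁻¹) s := by
    have hc : Tendsto (fun s => (p₀, s)) (𝓝 s₀) (𝓝 (p₀, s₀)) :=
      Continuous.tendsto' (by fun_prop) _ _ rfl
    filter_upwards [hc.eventually hA, hc.eventually
      (hA.self_of_nhds.continuousAt.eventually_ne hA0)] with s hs hs0
    exact (ContinuousAt.comp (g := A) (f := fun s => (p₀, s)) hs.continuousAt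
      (by fun_prop)).inv₀ hs0
  have hmeas : StronglyMeasurableAtFilter (fun s => (A (p₀, s))⁻¹) (𝓝 s₀) MeasureTheory.volume := by
    obtain ⟨V, hV, hVo, hsV⟩ := eventually_nhds_iff.1 hcont
    exact ContinuousAt.stronglyMeasurableAtFilter hVo hV s₀ hsV
  have h₁ : HasDerivAt (fun s => separableDefect A B ((p₀, s₀, u₀, u₀), s)) (A (p₀, s₀))⁻¹ s₀ :=
    (intervalIntegral.integral_hasDerivAt_right .refl hmeas
      hcont.self_of_nhds).sub_const (∫ u in u₀..u₀, B (p₀, u))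
  have h₂ := ((eventually_contDiffAt_separableDefect hA hA0
    hB).self_of_nhds.differentiableAt (by simp)).hasFDerivAt.comp_hasDerivAt s₀
      ((hasDerivAt_const s₀ (p₀, s₀, u₀, u₀)).prodMk (hasDerivAt_id s₀))
  refine ⟨ContinuousLinearEquiv.unitsEquivAut ℝ (Units.mk0 _ (inv_ne_zero hA0)), ?_⟩
  ext
  simpa using h₁.unique h₂

theorem exists_contDiffAt_separable_solution [CompleteSpace P]
    (hA : ∀ᶠ z in 𝓝 (p₀, s₀), ContDiffAt ℝ ∞ A z) (hA0 : A (p₀, s₀) ≠ 0)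
    (hB : ∀ᶠ z in 𝓝 (p₀, u₀), ContDiffAt ℝ ∞ B z) :
    ∃ S : P × ℝ × ℝ × ℝ → ℝ, S (p₀, s₀, u₀, u₀) = s₀ ∧
      (∀ᶠ w in 𝓝 (p₀, s₀, u₀, u₀), ContDiffAt ℝ ∞ S w) ∧
      ∀ᶠ w in 𝓝 (p₀, s₀, u₀, u₀), ∀ ψ : ℝ → ℝ, ψ w.2.2.1 = w.2.1 →
        (∀ u ∈ uIcc w.2.2.1 w.2.2.2, HasDerivAt ψ (A (w.1, ψ u) * B (w.1, u)) u) →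
        ψ w.2.2.2 = S w := by
  have hG := eventually_contDiffAt_separableDefect hA hA0 hB
  have hinv := isInvertible_fderiv_separableDefect hA hA0 hB
  refine ⟨hG.self_of_nhds.implicitFunction (by simp) hinv,
    ContDiffAt.implicitFunction_apply_self .., eventually_contDiffAt_implicitFunction hG hinv, ?_⟩
  have hAz : ∀ᶠ z in 𝓝 (p₀, s₀), ContinuousAt A z ∧ A z ≠ 0 :=
    (hA.mono fun z hz => hz.continuousAt).and
      (hA.self_of_nhds.continuousAt.eventually_ne hA0)
  have hpσ : Tendsto (fun z : (P × ℝ × ℝ × ℝ) × ℝ => (z.1.1, z.2)) (𝓝 ((p₀, s₀, u₀, u₀), s₀))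
      (𝓝 (p₀, s₀)) := Continuous.tendsto' (by fun_prop) _ _ rfl
  have hpu : Tendsto (fun w : P × ℝ × ℝ × ℝ => (w.1, w.2.2)) (𝓝 (p₀, s₀, u₀, u₀))
      (𝓝 (p₀, u₀, u₀)) := Continuous.tendsto' (by fun_prop) _ _ rfl
  obtain ⟨T, hT, V, hV, hTV⟩ := eventually_prod_iff.1
    (nhds_prod_eq (x := (p₀, s₀, u₀, u₀)) (y := s₀) ▸ (hpσ.eventually hAz).and
      (hG.self_of_nhds.eventually_apply_eq_iff_implicitFunction (by simp) hinv))
  have hF : ContinuousAt (fun z : P × ℝ × ℝ => A (z.1, z.2.2) * B (z.1, z.2.1)) (p₀, u₀, s₀) :=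
    (ContinuousAt.comp (f := fun z : P × ℝ × ℝ => (z.1, z.2.2)) hA.self_of_nhds.continuousAt
      (by fun_prop)).mul
    (ContinuousAt.comp (f := fun z : P × ℝ × ℝ => (z.1, z.2.1)) hB.self_of_nhds.continuousAt
      (by fun_prop))
  filter_upwards [hT, eventually_solution_mem_of_continuousAt hF hV,
    hpu.eventually (eventually_forall_uIcc hB)] with w hTw hVw hBw ψ hψw hψ
  have hmem := hVw ψ hψw hψ
  refine ((hTV hTw (hmem _ right_mem_uIcc)).2.1 ?_).symm
  rw [show separableDefect A B ((p₀, s₀, u₀, u₀), s₀) = 0 by simp [separableDefect]]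
  have := separableDefect_eq_zero hψ (fun v hv => (hTV hTw (hmem v hv)).1.1)
    (fun v hv => (hTV hTw (hmem v hv)).1.2) fun v hv => (hBw v hv).continuousAt
  rwa [hψw] at this

end

/-! ### Derivatives of web symmetries -/

section OpenSubset

variable {W : Type*} [NormedAddCommGroup W] [NormedSpace ℝ W] {U : Opens W} {Φ : U → U} {F : W → W}
  {p : U}

theorem hasMFDerivAt_subtype_val (p : U) :
    HasMFDerivAt 𝓘(ℝ, W) 𝓘(ℝ, W) (Subtype.val : U → W) p (ContinuousLinearMap.id ℝ W) := by
  refine ⟨continuous_subtype_val.continuousAt, ?_⟩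
  have hp : extChartAt 𝓘(ℝ, W) p p = (p : W) := by simp [extChartAt]; rfl
  rw [hp]
  refine (HasFDerivAt.congr_of_eventuallyEq (hasFDerivAt_id (p : W)) ?_).hasFDerivWithinAt
  filter_upwards [U.isOpen.mem_nhds p.2] with y hy
  simp only [writtenInExtChartAt, extChartAt, Function.comp, mfld_simps]
  have hchart := (OpenPartialHomeomorph.refl W).subtypeRestr_symm_eqOn (U := U) ⟨p⟩
  exact (hchart (x := y) (by simpa [OpenPartialHomeomorph.subtypeRestr] using hy)).symm

theorem contDiffAt_of_contMDiffAt (h : ∀ p : U, (Φ p : W) = F p)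
    (hΦ : ContMDiffAt 𝓘(ℝ, W) 𝓘(ℝ, W) ∞ Φ p) : ContDiffAt ℝ ∞ F p := by
  rw [← contMDiffAt_iff_contDiffAt, ← contMDiffAt_subtype_iff]
  exact (funext h : Subtype.val ∘ Φ = fun x : U => F x) ▸
    (ContMDiffAt.subtypeVal_comp_iff U Φ p).2 hΦ

theorem differentiableAt_of_contMDiffAt (h : ∀ p : U, (Φ p : W) = F p)
    (hΦ : ContMDiffAt 𝓘(ℝ, W) 𝓘(ℝ, W) ∞ Φ p) : DifferentiableAt ℝ F p :=
  (contDiffAt_of_contMDiffAt h hΦ).differentiableAt (by simp)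

theorem mfderiv_opens_eq_fderiv (h : ∀ p : U, (Φ p : W) = F p)
    (hΦ : ContMDiffAt 𝓘(ℝ, W) 𝓘(ℝ, W) ∞ Φ p) (v : W) :
    (mfderiv 𝓘(ℝ, W) 𝓘(ℝ, W) Φ p v : W) = fderiv ℝ F p v := by
  have hval := (hasMFDerivAt_subtype_val (Φ p)).comp p
    (hΦ.mdifferentiableAt (by simp)).hasMFDerivAt
  have hF := HasMFDerivAt.comp p (g := F)
    (differentiableAt_of_contMDiffAt h hΦ).hasFDerivAt.hasMFDerivAt (hasMFDerivAt_subtype_val p)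
  rw [(funext h : Subtype.val ∘ Φ = F ∘ Subtype.val)] at hval
  exact DFunLike.congr_fun (hasMFDerivAt_unique hval hF) v

end OpenSubset

section WebFun

open Function

variable {n : ℕ} {U : Opens (TX n)} {f : (Fin n → ℝ) → Fin n → ℝ}

/-- The map `(t, x) ↦ (φ₀ t, φ₁ x₁, …, φₙ xₙ)` of the whole space: a web map of `U` is the
restriction of such a map to `U`. -/
def webFun (φ₀ : ℝ → ℝ) (φ : Fin n → ℝ → ℝ) (p : TX n) : TX n := (φ₀ p.1, fun i => φ i (p.2 i))

variable {φ₀ : ℝ → ℝ} {φ : Fin n → ℝ → ℝ}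

theorem differentiableAt_fst_of_webFun {p : TX n} (h : DifferentiableAt ℝ (webFun φ₀ φ) p) :
    DifferentiableAt ℝ φ₀ p.1 :=
  (DifferentiableAt.comp (f := fun t : ℝ => (t, p.2)) p.1 h (by fun_prop)).fst

theorem differentiableAt_snd_of_webFun {p : TX n} (h : DifferentiableAt ℝ (webFun φ₀ φ) p)
    (i : Fin n) : DifferentiableAt ℝ (φ i) (p.2 i) := by
  have hline : DifferentiableAt ℝ (fun u : ℝ => (p.1, update p.2 i u)) (p.2 i) :=
    (differentiableAt_const _).prodMk (hasDerivAt_update p.2 i (p.2 i)).differentiableAt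
  have hp : (p.1, update p.2 i (p.2 i)) = p := by rw [update_eq_self]
  simpa [webFun, comp_def] using differentiableAt_pi.1
    (DifferentiableAt.comp (g := webFun φ₀ φ) (p.2 i) (hp.symm ▸ h) hline).snd i

theorem fderiv_webFun {p : TX n} (h : DifferentiableAt ℝ (webFun φ₀ φ) p) (v : TX n) :
    fderiv ℝ (webFun φ₀ φ) p v = (deriv φ₀ p.1 * v.1, fun i => deriv (φ i) (p.2 i) * v.2 i) := by
  have hfst : HasFDerivAt (fun p : TX n => φ₀ p.1)
      (deriv φ₀ p.1 • ContinuousLinearMap.fst ℝ ℝ (Fin n → ℝ)) p :=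
    (differentiableAt_fst_of_webFun h).hasDerivAt.comp_hasFDerivAt p hasFDerivAt_fst
  have hsnd : ∀ i, HasFDerivAt (fun p : TX n => φ i (p.2 i)) (deriv (φ i) (p.2 i) •
      (ContinuousLinearMap.proj i).comp (ContinuousLinearMap.snd ℝ ℝ (Fin n → ℝ))) p := fun i =>
    (differentiableAt_snd_of_webFun h i).hasDerivAt.comp_hasFDerivAt p
      (((ContinuousLinearMap.proj (R := ℝ) (φ := fun _ : Fin n => ℝ) i).hasFDerivAt).comp p
        hasFDerivAt_snd)
  have hweb : HasFDerivAt (webFun φ₀ φ) _ p := hfst.prodMk (hasFDerivAt_pi.2 hsnd)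
  rw [hweb.fderiv]
  ext <;> simp

theorem IsWebMap.exists_eq_webFun {Φ : U → U} (h : IsWebMap Φ) :
    ∃ (φ₀ : ℝ → ℝ) (φ : Fin n → ℝ → ℝ), ∀ p : U, (Φ p : TX n) = webFun φ₀ φ p := h

theorem snd_apply_update {Φ : U → U} (hw : ∀ p : U, (Φ p : TX n) = webFun φ₀ φ p) (p : U)
    {k : Fin n} {u : ℝ} (hu : (p.1.1, update p.1.2 k u) ∈ U) :
    (Φ ⟨_, hu⟩).1.2 = update (Φ p).1.2 k (φ k u) := by
  ext l
  rcases eq_or_ne l k with rfl | hl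
  · simp [hw, webFun]
  · simp [hw, webFun, hl]

theorem contMDiff_deriv_of_webFun {Φ : U → U} (hΦ : ContMDiff 𝓘(ℝ, TX n) 𝓘(ℝ, TX n) ∞ Φ)
    (hw : ∀ p : U, (Φ p : TX n) = webFun φ₀ φ p) (i : Fin n) :
    ContMDiff 𝓘(ℝ, TX n) 𝓘(ℝ, ℝ) ∞ fun p : U => deriv (φ i) (p.1.2 i) := by
  intro p
  have hderiv : ContDiffAt ℝ ∞ (fun x => fderiv ℝ (webFun φ₀ φ) x (0, Pi.single i 1)) (p : TX n) :=
    ((contDiffAt_of_contMDiffAt hw (hΦ p)).fderiv_right (m := ∞) (by simp)).clm_apply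
      contDiffAt_const
  have hsnd := contMDiffAt_subtype_iff.2 (contDiffAt_pi.1 hderiv.snd i).contMDiffAt
  refine hsnd.congr_of_eventuallyEq (.of_forall fun q => ?_)
  simp [fderiv_webFun (differentiableAt_of_contMDiffAt hw (hΦ q))]

variable {Φ : U ≃ₜ U}

theorem deriv_ne_zero_of_web (hΦ : ContMDiff 𝓘(ℝ, TX n) 𝓘(ℝ, TX n) ∞ Φ)
    (hΦ' : ContMDiff 𝓘(ℝ, TX n) 𝓘(ℝ, TX n) ∞ Φ.symm) (hw : ∀ p : U, (Φ p : TX n) = webFun φ₀ φ p)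
    (hw' : IsWebMap Φ.symm) (p : U) :
    deriv φ₀ p.1.1 ≠ 0 ∧ ∀ i, deriv (φ i) (p.1.2 i) ≠ 0 := by
  obtain ⟨ψ₀, ψ, hψ⟩ := hw'.exists_eq_webFun
  have hφd := differentiableAt_of_contMDiffAt hw (hΦ p)
  have hψd := differentiableAt_of_contMDiffAt hψ (hΦ' (Φ p))
  rw [hw p] at hψd
  have hinv : webFun ψ₀ ψ ∘ webFun φ₀ φ =ᶠ[𝓝 (p : TX n)] id := by
    filter_upwards [U.isOpen.mem_nhds p.2] with y hy
    have hy' := hψ (Φ ⟨y, hy⟩)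
    rw [Homeomorph.symm_apply_apply, hw ⟨y, hy⟩] at hy'
    exact hy'.symm
  have hcomp := fderiv_comp (p : TX n) hψd hφd
  rw [hinv.fderiv_eq, fderiv_id] at hcomp
  have hid : ∀ v : TX n, v = fderiv ℝ (webFun ψ₀ ψ) (webFun φ₀ φ p)
      (fderiv ℝ (webFun φ₀ φ) p v) := DFunLike.congr_fun hcomp
  simp only [fderiv_webFun hφd, fderiv_webFun hψd] at hid
  refine ⟨fun h0 => ?_, fun i h0 => ?_⟩
  · simpa [h0] using congrArg Prod.fst (hid (1, 0))
  · simpa [h0] using congrFun (congrArg Prod.snd (hid (0, Pi.single i 1))) i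

theorem contactForm_apply (i : Fin n) (p v : TX n) :
    contactForm f i p v = v.2 i - f p.2 i * v.1 := by
  simp [contactForm]

theorem contactForm_mfderiv {Φ : U → U} {p : U} (hw : ∀ p : U, (Φ p : TX n) = webFun φ₀ φ p)
    (hΦ : ContMDiffAt 𝓘(ℝ, TX n) 𝓘(ℝ, TX n) ∞ Φ p) (i : Fin n) (v : TX n) :
    contactForm f i (Φ p) (mfderiv 𝓘(ℝ, TX n) 𝓘(ℝ, TX n) Φ p v) =
      deriv (φ i) (p.1.2 i) * v.2 i - f (Φ p).1.2 i * (deriv φ₀ p.1.1 * v.1) :=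
  (congrArg (contactForm f i (Φ p)) ((mfderiv_opens_eq_fderiv hw hΦ v).trans
    (fderiv_webFun (differentiableAt_of_contMDiffAt hw hΦ) v))).trans (contactForm_apply _ _ _)

theorem IsWebSymmetry.deriv_mul_eq (h : IsWebSymmetry f Φ)
    (hw : ∀ p : U, (Φ p : TX n) = webFun φ₀ φ p) (p : U) (i : Fin n) :
    deriv (φ i) (p.1.2 i) * f p.1.2 i = deriv φ₀ p.1.1 * f (Φ p).1.2 i := by
  obtain ⟨a, -, -, ha⟩ := h.preserves
  have hpull := (contactForm_mfderiv hw (h.smooth p) i (1, f p.1.2)).symm.trans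
    (ha p i (1, f p.1.2))
  simp only [contactForm_apply, mul_one, sub_self, mul_zero, Finset.sum_const_zero] at hpull
  linarith

theorem isWebSymmetry_of_deriv_mul_eq (hΦ : ContMDiff 𝓘(ℝ, TX n) 𝓘(ℝ, TX n) ∞ Φ)
    (hΦ' : ContMDiff 𝓘(ℝ, TX n) 𝓘(ℝ, TX n) ∞ Φ.symm) (hw : ∀ p : U, (Φ p : TX n) = webFun φ₀ φ p)
    (hw' : IsWebMap Φ.symm)
    (h : ∀ (p : U) i, deriv (φ i) (p.1.2 i) * f p.1.2 i = deriv φ₀ p.1.1 * f (Φ p).1.2 i) :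
    IsWebSymmetry f Φ := by
  refine ⟨hΦ, hΦ', ⟨φ₀, φ, hw⟩, hw',
    fun p => Matrix.diagonal fun i => deriv (φ i) (p.1.2 i), fun i j => ?_, fun p => ?_,
    fun p i v => ?_⟩
  · rcases eq_or_ne i j with rfl | hij
    · simpa only [Matrix.diagonal_apply_eq] using contMDiff_deriv_of_webFun hΦ hw i
    · simpa only [Matrix.diagonal_apply_ne _ hij] using contMDiff_const
  · rw [Matrix.det_diagonal]
    exact (Finset.prod_ne_zero_iff.2 fun i _ =>
      (deriv_ne_zero_of_web hΦ hΦ' hw hw' p).2 i).isUnit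
  · rw [contactForm_mfderiv hw (hΦ p)]
    simp only [contactForm_apply, Matrix.diagonal_apply, ite_mul, zero_mul, Finset.sum_ite_eq,
      Finset.mem_univ, if_true]
    linear_combination v.1 * h p i

theorem ell_eq {x : Fin n → ℝ} {i : Fin n} (j : Fin n) (hf : DifferentiableAt ℝ f x)
    (h0 : f x i ≠ 0) :
    ell f i j x = f x j * ((f x i)⁻¹ * fderiv ℝ (fun y => f y i) x (Pi.single j 1)) := by
  simp only [ell, Real.log_abs]
  rw [((differentiableAt_pi.1 hf i).hasFDerivAt.log h0).fderiv]
  simp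

theorem hasDerivAt_comp_update {g : (Fin n → ℝ) → ℝ} {x : Fin n → ℝ} (hg : DifferentiableAt ℝ g x)
    (j : Fin n) {ψ : ℝ → ℝ} {d u : ℝ} (hψ : HasDerivAt ψ d u) (hu : ψ u = x j) :
    HasDerivAt (fun u => g (update x j (ψ u))) (fderiv ℝ g x (Pi.single j 1) * d) u := by
  have hx : update x j (ψ u) = x := by rw [hu, update_eq_self]
  have hline : HasDerivAt (fun s => g (update x j s)) (fderiv ℝ g x (Pi.single j 1)) (ψ u) :=
    HasFDerivAt.comp_hasDerivAt (f := update x j) (ψ u) (hx.symm ▸ hg.hasFDerivAt)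
      (hasDerivAt_update x j (ψ u))
  exact hline.comp u hψ

theorem IsWebSymmetry.deriv_mul_fderiv (h : IsWebSymmetry f Φ)
    (hw : ∀ p : U, (Φ p : TX n) = webFun φ₀ φ p)
    (hf : ∀ p ∈ U, DifferentiableAt ℝ f p.2) {i j : Fin n} (hij : i ≠ j) (p : U) :
    deriv (φ i) (p.1.2 i) * fderiv ℝ (fun y => f y i) p.1.2 (Pi.single j 1) =
      deriv φ₀ p.1.1 * (fderiv ℝ (fun y => f y i) (Φ p).1.2 (Pi.single j 1) *
        deriv (φ j) (p.1.2 j)) := by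
  have hφ := differentiableAt_snd_of_webFun (differentiableAt_of_contMDiffAt hw (h.smooth p)) j
  have hfi : ∀ p ∈ U, DifferentiableAt ℝ (fun y => f y i) p.2 :=
    fun p hp => differentiableAt_pi.1 (hf p hp) i
  have hev : ∀ᶠ u in 𝓝 (p.1.2 j), deriv (φ i) (p.1.2 i) * f (update p.1.2 j u) i =
      deriv φ₀ p.1.1 * f (update (Φ p).1.2 j (φ j u)) i := by
    have hcont : Filter.Tendsto (fun u => (p.1.1, update p.1.2 j u)) (𝓝 (p.1.2 j)) (𝓝 p.1) :=
      Continuous.tendsto' (by fun_prop) _ _ (by simp)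
    filter_upwards [hcont.eventually (U.isOpen.mem_nhds p.2)] with u hu
    simpa [snd_apply_update hw p hu, hij] using h.deriv_mul_eq hw ⟨_, hu⟩ i
  have hl := (hasDerivAt_comp_update (hfi p p.2) j (hasDerivAt_id (p.1.2 j)) rfl).const_mul
    (deriv (φ i) (p.1.2 i))
  have hr := (hasDerivAt_comp_update (hfi _ (Φ p).2) j hφ.hasDerivAt
    (by simp [hw, webFun])).const_mul (deriv φ₀ p.1.1)
  simpa using hl.unique (hr.congr_of_eventuallyEq hev)

theorem IsWebSymmetry.deriv_mul_ell (h : IsWebSymmetry f Φ)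
    (hw : ∀ p : U, (Φ p : TX n) = webFun φ₀ φ p)
    (hf : ∀ p ∈ U, DifferentiableAt ℝ f p.2) (hf0 : ∀ p ∈ U, ∀ i, f p.2 i ≠ 0) {i j : Fin n}
    (hij : i ≠ j) (p : U) :
    deriv φ₀ p.1.1 * ell f i j (Φ p).1.2 = ell f i j p.1.2 := by
  rw [ell_eq j (hf p p.2) (hf0 p p.2 i), ell_eq j (hf _ (Φ p).2) (hf0 _ (Φ p).2 i)]
  have hφ₀ := (deriv_ne_zero_of_web h.smooth h.smooth_symm hw h.web_symm p).1
  have hi := h.deriv_mul_eq hw p i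
  have hj := h.deriv_mul_eq hw p j
  have hmixed := h.deriv_mul_fderiv hw hf hij p
  have hp := hf0 p p.2 i
  have hΦp := hf0 _ (Φ p).2 i
  set A := fderiv ℝ (fun y => f y i) p.1.2 (Pi.single j 1)
  set B := fderiv ℝ (fun y => f y i) (Φ p).1.2 (Pi.single j 1)
  set c := deriv φ₀ p.1.1
  field_simp
  apply mul_left_cancel₀ hφ₀
  linear_combination (f p.1.2 i * B) * (-c) * hj + (f p.1.2 i * f p.1.2 j) * (-hmixed) +
    A * f p.1.2 j * hi

end WebFun

/-! ### The local formula for web symmetries -/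

section LocalFormula

open Filter Function

variable {n : ℕ} {U : Opens (TX n)} {f : (Fin n → ℝ) → Fin n → ℝ}

theorem contDiffAt_snd_of_mem (hf : ContDiffOn ℝ ∞ f (Prod.snd '' (U : Set (TX n)))) {p : TX n}
    (hp : p ∈ U) : ContDiffAt ℝ ∞ f p.2 :=
  hf.contDiffAt ((isOpenMap_snd _ U.isOpen).mem_nhds ⟨p, hp, rfl⟩)

theorem contDiffAt_ell {x : Fin n → ℝ} (hf : ContDiffAt ℝ ∞ f x) {i : Fin n} (h0 : f x i ≠ 0)
    (j : Fin n) : ContDiffAt ℝ ∞ (ell f i j) x := by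
  have hlog : ContDiffAt ℝ ∞ (fun y => Real.log |f y i|) x := by
    simpa only [Real.log_abs] using (contDiffAt_pi.1 hf i).log h0
  exact (contDiffAt_pi.1 hf j).mul ((hlog.fderiv_right (m := ∞) (by simp)).clm_apply
    contDiffAt_const)

/-- A smooth system with nonvanishing `f₁, …, fₙ` and nonvanishing `ℓ_{ij}`, where `i ≠ j`. -/
structure IsEllRegular (f : (Fin n → ℝ) → Fin n → ℝ) (U : Opens (TX n)) (i j : Fin n) : Prop where
  contDiffOn : ContDiffOn ℝ ∞ f (Prod.snd '' (U : Set (TX n)))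
  apply_ne_zero : ∀ p ∈ U, ∀ k, f p.2 k ≠ 0
  index_ne : i ≠ j
  ell_ne_zero : ∀ p ∈ U, ell f i j p.2 ≠ 0

/-- The derivative of the time component of a web symmetry which maps `x` to `y`, as determined by
the invariant `ℓ_{ij}`. -/
noncomputable def timeScale (f : (Fin n → ℝ) → Fin n → ℝ) (i j : Fin n) (x y : Fin n → ℝ) : ℝ :=
  ell f i j x / ell f i j y

/-- The factor `A` of the separable equation `φₖ' = A (z, φₖ) B (z, u)` satisfied by the components
of a web symmetry which maps `z.1` to `z.2.1`. -/
def imageFactor (f : (Fin n → ℝ) → Fin n → ℝ) (k : Fin n) (w : (TX n × TX n × TX n) × ℝ) : ℝ :=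
  f (update w.1.2.1.2 k w.2) k

/-- The factor `B` of the separable equation described at `imageFactor`. -/
noncomputable def sourceFactor (f : (Fin n → ℝ) → Fin n → ℝ) (i j k : Fin n)
    (w : (TX n × TX n × TX n) × ℝ) : ℝ :=
  timeScale f i j w.1.1.2 w.1.2.1.2 * (f (update w.1.1.2 k w.2) k)⁻¹

variable {i j : Fin n}

namespace IsEllRegular

theorem contDiffAt_timeScale (hf : IsEllRegular f U i j) {p q : TX n} (hp : p ∈ U) (hq : q ∈ U) :
    ContDiffAt ℝ ∞ (fun z : TX n × TX n => timeScale f i j z.1.2 z.2.2) (p, q) := by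
  have hell : ∀ p ∈ U, ContDiffAt ℝ ∞ (fun z : TX n => ell f i j z.2) p := fun p hp =>
    (contDiffAt_ell (contDiffAt_snd_of_mem hf.contDiffOn hp) (hf.apply_ne_zero p hp i) j).comp p
      contDiffAt_snd
  exact ((hell p hp).comp (p, q) contDiffAt_fst).div (g := fun z => ell f i j z.2.2)
    ((hell q hq).comp (p, q) contDiffAt_snd) (hf.ell_ne_zero q hq)

theorem contDiffAt_apply_update (hf : IsEllRegular f U i j) (k : Fin n) {t : ℝ} {x : Fin n → ℝ}
    {s : ℝ} (hs : (t, update x k s) ∈ U) :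
    ContDiffAt ℝ ∞ (fun z : (Fin n → ℝ) × ℝ => f (update z.1 k z.2) k) (x, s) := by
  have hupdate : ContDiff ℝ ∞ fun z : (Fin n → ℝ) × ℝ => update z.1 k z.2 := by
    refine contDiff_pi.2 fun l => ?_
    rcases eq_or_ne l k with rfl | hl
    · simpa only [update_self] using contDiff_snd
    · simpa only [update_of_ne hl] using contDiff_pi.1 contDiff_fst l
  exact (contDiffAt_pi.1 (contDiffAt_snd_of_mem hf.contDiffOn hs) k).comp (x, s)
    hupdate.contDiffAt

theorem eventually_contDiffAt_imageFactor (hf : IsEllRegular f U i j) (k : Fin n) {p b q : TX n}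
    (hb : b ∈ U) : ∀ᶠ w in 𝓝 ((p, b, q), b.2 k), ContDiffAt ℝ ∞ (imageFactor f k) w := by
  have hmove : Tendsto (fun w : (TX n × TX n × TX n) × ℝ => (w.1.2.1.1, update w.1.2.1.2 k w.2))
      (𝓝 ((p, b, q), b.2 k)) (𝓝 b) := Continuous.tendsto' (by fun_prop) _ _ (by simp)
  filter_upwards [hmove.eventually (U.isOpen.mem_nhds hb)] with w hw
  exact (hf.contDiffAt_apply_update k hw).comp
    (f := fun w : (TX n × TX n × TX n) × ℝ => (w.1.2.1.2, w.2)) w (by fun_prop)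

theorem imageFactor_ne_zero (hf : IsEllRegular f U i j) (k : Fin n) {p b q : TX n} (hb : b ∈ U) :
    imageFactor f k ((p, b, q), b.2 k) ≠ 0 := by
  simpa [imageFactor] using hf.apply_ne_zero b hb k

theorem eventually_contDiffAt_sourceFactor (hf : IsEllRegular f U i j) (k : Fin n) {p b q : TX n}
    (hp : p ∈ U) (hb : b ∈ U) :
    ∀ᶠ w in 𝓝 ((p, b, q), p.2 k), ContDiffAt ℝ ∞ (sourceFactor f i j k) w := by
  have hmove : Tendsto (fun w : (TX n × TX n × TX n) × ℝ => (w.1.1.1, update w.1.1.2 k w.2))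
      (𝓝 ((p, b, q), p.2 k)) (𝓝 p) := Continuous.tendsto' (by fun_prop) _ _ (by simp)
  have hpU : ∀ᶠ w in 𝓝 ((p, b, q), p.2 k), w.1.1 ∈ U :=
    (Continuous.tendsto' (by fun_prop) _ _ rfl).eventually (U.isOpen.mem_nhds hp)
  have hbU : ∀ᶠ w in 𝓝 ((p, b, q), p.2 k), w.1.2.1 ∈ U :=
    (Continuous.tendsto' (by fun_prop) _ _ rfl).eventually (U.isOpen.mem_nhds hb)
  filter_upwards [hmove.eventually (U.isOpen.mem_nhds hp), hpU, hbU] with w hw hwp hwb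
  refine ((hf.contDiffAt_timeScale hwp hwb).comp
    (f := fun w : (TX n × TX n × TX n) × ℝ => (w.1.1, w.1.2.1)) w (by fun_prop)).mul
      (ContDiffAt.inv ?_ (hf.apply_ne_zero _ hw k))
  exact (hf.contDiffAt_apply_update k hw).comp
    (f := fun w : (TX n × TX n × TX n) × ℝ => (w.1.1.2, w.2)) w (by fun_prop)

end IsEllRegular

variable {Φ : U ≃ₜ U} {φ₀ : ℝ → ℝ} {φ : Fin n → ℝ → ℝ}

theorem IsWebSymmetry.deriv_fst_eq_timeScale (h : IsWebSymmetry f Φ) (hf : IsEllRegular f U i j)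
    (hw : ∀ p : U, (Φ p : TX n) = webFun φ₀ φ p) (p : U) :
    deriv φ₀ p.1.1 = timeScale f i j p.1.2 (Φ p).1.2 :=
  eq_div_of_mul_eq (hf.ell_ne_zero _ (Φ p).2) (h.deriv_mul_ell hw
    (fun _ hp => (contDiffAt_snd_of_mem hf.contDiffOn hp).differentiableAt (by simp))
    hf.apply_ne_zero hf.index_ne p)

theorem IsWebSymmetry.fst_apply (h : IsWebSymmetry f Φ) (hf : IsEllRegular f U i j) {x y : U}
    (hxy : ∀ t ∈ uIcc x.1.1 y.1.1, (t, x.1.2) ∈ U) :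
    (Φ y).1.1 = (Φ x).1.1 + timeScale f i j x.1.2 (Φ x).1.2 * (y.1.1 - x.1.1) := by
  obtain ⟨φ₀, φ, hw⟩ := h.web.exists_eq_webFun
  have hφ₀ : ∀ t ∈ uIcc x.1.1 y.1.1,
      HasDerivAt φ₀ (timeScale f i j x.1.2 (Φ x).1.2) t := by
    intro t ht
    have hd := differentiableAt_of_contMDiffAt hw (h.smooth ⟨_, hxy t ht⟩)
    have hder := h.deriv_fst_eq_timeScale hf hw ⟨_, hxy t ht⟩
    have hΦ : (Φ ⟨_, hxy t ht⟩).1.2 = (Φ x).1.2 := by simp [hw, webFun]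
    rw [hΦ] at hder
    exact hder ▸ (differentiableAt_fst_of_webFun hd).hasDerivAt
  have hint := intervalIntegral.integral_eq_sub_of_hasDerivAt hφ₀ intervalIntegrable_const
  rw [intervalIntegral.integral_const, smul_eq_mul] at hint
  simp only [hw, webFun] at hint ⊢
  linarith

theorem IsWebSymmetry.hasDerivAt_snd (h : IsWebSymmetry f Φ) (hf : IsEllRegular f U i j)
    (hw : ∀ p : U, (Φ p : TX n) = webFun φ₀ φ p) {x : U} {u : ℝ} {k : Fin n}
    (hu : (x.1.1, update x.1.2 k u) ∈ U) :
    HasDerivAt (φ k) (f (update (Φ x).1.2 k (φ k u)) k *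
      (timeScale f i j x.1.2 (Φ x).1.2 * (f (update x.1.2 k u) k)⁻¹)) u := by
  have hd := differentiableAt_snd_of_webFun
    (differentiableAt_of_contMDiffAt hw (h.smooth ⟨_, hu⟩)) k
  have hmul := h.deriv_mul_eq hw ⟨_, hu⟩ k
  rw [snd_apply_update hw x hu, h.deriv_fst_eq_timeScale hf hw x] at hmul
  simp only [update_self] at hd hmul
  have hder : deriv (φ k) u = f (update (Φ x).1.2 k (φ k u)) k *
      (timeScale f i j x.1.2 (Φ x).1.2 * (f (update x.1.2 k u) k)⁻¹) := by
    rw [← mul_assoc, eq_mul_inv_iff_mul_eq₀ (hf.apply_ne_zero _ hu k), hmul, mul_comm]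
  exact hder ▸ hd.hasDerivAt

theorem eventually_forall_uIcc_mem {c : TX n × ℝ → TX n} (hc : Continuous c) {s : TX n → ℝ}
    (hs : Continuous s) (hcs : ∀ p, c (p, s p) = p) (q b : U) :
    ∀ᶠ z : U × U × U in 𝓝 (q, b, q), ∀ u ∈ uIcc (s z.1) (s z.2.2), c (z.1, u) ∈ U := by
  have hmem : ∀ᶠ w in 𝓝 ((q : TX n), s q), c w ∈ U :=
    (hc.tendsto' _ _ (hcs q)).eventually (U.isOpen.mem_nhds q.2)
  have hends : Tendsto (fun z : U × U × U => ((z.1 : TX n), s z.1, s z.2.2)) (𝓝 (q, b, q))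
      (𝓝 ((q : TX n), s q, s q)) := Continuous.tendsto' (by fun_prop) _ _ rfl
  exact hends.eventually (eventually_forall_uIcc hmem)

theorem exists_snd_formula (hf : IsEllRegular f U i j) (q b : U) (k : Fin n) :
    ∃ S : TX n × TX n × TX n → ℝ,
      (∀ᶠ z in 𝓝 ((q : TX n), (b : TX n), (q : TX n)), ContDiffAt ℝ ∞ S z) ∧
      S (q, b, q) = b.1.2 k ∧
      ∀ᶠ z : U × U × U in 𝓝 (q, b, q), ∀ g : U ≃ₜ U, IsWebSymmetry f g → g z.1 = z.2.1 →
        (g z.2.2).1.2 k = S (z.1, z.2.1, z.2.2) := by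
  have hmove : Continuous fun w : TX n × ℝ => (w.1.1, update w.1.2 k w.2) := by fun_prop
  obtain ⟨S, hS0, hS, hSeq⟩ := exists_contDiffAt_separable_solution
    (hf.eventually_contDiffAt_imageFactor k (p := q) (q := q) b.2) (hf.imageFactor_ne_zero k b.2)
    (hf.eventually_contDiffAt_sourceFactor k q.2 b.2)
  have hcont : ContDiff ℝ ∞ fun z : TX n × TX n × TX n => (z, z.2.1.2 k, z.1.2 k, z.2.2.2 k) := by
    fun_prop
  have hcoe : Tendsto (fun z : U × U × U => ((z.1 : TX n), (z.2.1 : TX n), (z.2.2 : TX n)))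
      (𝓝 (q, b, q)) (𝓝 ((q : TX n), (b : TX n), (q : TX n))) :=
    Continuous.tendsto' (by fun_prop) _ _ rfl
  refine ⟨fun z => S (z, z.2.1.2 k, z.1.2 k, z.2.2.2 k), ?_, hS0, ?_⟩
  · filter_upwards [(hcont.continuous.tendsto _).eventually hS] with z hz
    exact hz.comp z hcont.contDiffAt
  · have hseg := eventually_forall_uIcc_mem (s := fun p : TX n => p.2 k) hmove (by fun_prop)
      (by simp) q b
    filter_upwards [hcoe.eventually ((hcont.continuous.tendsto _).eventually hSeq), hseg]
      with z hz hseg g hg hgz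
    obtain ⟨φ₀, φ, hw⟩ := hg.web.exists_eq_webFun
    have hgk : ∀ p : U, (g p).1.2 k = φ k (p.1.2 k) := fun p => by rw [hw]; rfl
    rw [hgk]
    refine hz (φ k) (by rw [← hgk, hgz]) fun u hu => ?_
    exact hgz ▸ hg.hasDerivAt_snd hf hw (hseg u hu)

theorem hasLocalFormula_webSymmetry (hf : IsEllRegular f U i j) :
    HasLocalFormula (webSymmetrySubgroup f U) := by
  refine ⟨fun q b => ?_⟩
  choose S hS hS0 hSeq using exists_snd_formula hf q b
  refine ⟨fun z => (z.2.1.1 + timeScale f i j z.1.2 z.2.1.2 * (z.2.2.1 - z.1.1), fun k => S k z),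
    ?_, ?_, ?_⟩
  · have hU : ∀ᶠ z in 𝓝 ((q : TX n), (b : TX n), (q : TX n)), z.1 ∈ U ∧ z.2.1 ∈ U :=
      (continuous_fst.tendsto' _ _ rfl |>.eventually (U.isOpen.mem_nhds q.2)).and
        ((Continuous.tendsto' (by fun_prop) _ _ rfl).eventually (U.isOpen.mem_nhds b.2))
    filter_upwards [hU, eventually_all.2 hS] with z ⟨hz, hz'⟩ hSz
    have hscale : ContDiffAt ℝ ∞ (fun z : TX n × TX n × TX n => timeScale f i j z.1.2 z.2.1.2) z :=
      (hf.contDiffAt_timeScale hz hz').comp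
        (f := fun z : TX n × TX n × TX n => (z.1, z.2.1)) z (by fun_prop)
    exact ContDiffAt.prodMk (by fun_prop) (contDiffAt_pi.2 hSz)
  · ext k
    · simp
    · exact hS0 k
  · have hseg := eventually_forall_uIcc_mem (c := fun w : TX n × ℝ => (w.2, w.1.2)) (by fun_prop)
      continuous_fst (fun _ => rfl) q b
    filter_upwards [hseg, eventually_all.2 hSeq] with z hz hSz g hg hgz
    ext k
    · exact hgz ▸ IsWebSymmetry.fst_apply hg hf hz
    · exact hSz k g hg hgz

end LocalFormula

/-! ### Limits of web symmetries -/

namespace HasLocalFormula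

open Filter

variable {W : Type*} [NormedAddCommGroup W] [NormedSpace ℝ W] {U : Opens W}
  {H : Subgroup (U ≃ₜ U)} {ι : Type*} {l : Filter ι} [l.NeBot] {Γ : ι → H} {Φ : U → U}

theorem exists_limit_formula (hH : HasLocalFormula H)
    (hΦ : ∀ q, Tendsto (fun i => (Γ i).1 q) l (𝓝 (Φ q))) (q : U) :
    ∃ m : W × W → W, ContDiffAt ℝ ∞ m (Φ q, q) ∧ (∀ᶠ y in 𝓝 q, (Φ y : W) = m (Φ q, y)) ∧
      ∀ᶠ i in l, ContDiffAt ℝ ∞ m ((Γ i).1 q, q) ∧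
        ∀ᶠ y in 𝓝 q, ((Γ i).1 y : W) = m ((Γ i).1 q, y) := by
  obtain ⟨E, hE, -, hform⟩ := hH.exists_formula q (Φ q)
  set m : W × W → W := fun w => E (q, w.1, w.2)
  have hsmooth : ∀ᶠ z : U × U in 𝓝 (Φ q, q), ContDiffAt ℝ ∞ m (z.1, z.2) := by
    have hc : Continuous fun z : U × U => ((q : W), (z.1 : W), (z.2 : W)) := by fun_prop
    filter_upwards [(hc.tendsto (Φ q, q)).eventually hE] with z hz
    exact hz.comp (f := fun w : W × W => ((q : W), w.1, w.2)) ((z.1 : W), (z.2 : W)) (by fun_prop)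
  have hformula : ∀ᶠ z : U × U in 𝓝 (Φ q, q), ∀ g ∈ H, g q = z.1 → (g z.2 : W) = m (z.1, z.2) := by
    have hc : Continuous fun z : U × U => (q, z.1, z.2) := by fun_prop
    exact (hc.tendsto (Φ q, q)).eventually hform
  obtain ⟨M, N, hM, hΦM, hN, hqN, hMN⟩ := mem_nhds_prod_iff'.1 (hsmooth.and hformula)
  have hsmoothMN : ∀ a ∈ M, ∀ y ∈ N, ContDiffAt ℝ ∞ m (a, y) := fun a ha y hy =>
    (hMN (show (a, y) ∈ M ×ˢ N from ⟨ha, hy⟩)).1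
  have hformulaMN : ∀ a ∈ M, ∀ y ∈ N, ∀ g ∈ H, g q = a → (g y : W) = m (a, y) := fun a ha y hy =>
    (hMN (show (a, y) ∈ M ×ˢ N from ⟨ha, hy⟩)).2
  have hev : ∀ᶠ i in l, (Γ i).1 q ∈ M := (hΦ q).eventually (hM.mem_nhds hΦM)
  have hlim : ∀ y, Tendsto (fun i => ((Γ i).1 y : W)) l (𝓝 (Φ y : W)) := fun y =>
    (continuous_subtype_val.tendsto _).comp (hΦ y)
  refine ⟨m, hsmoothMN _ hΦM q hqN, ?_, ?_⟩
  · filter_upwards [hN.mem_nhds hqN] with y hy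
    have hmlim := (hsmoothMN _ hΦM y hy).continuousAt.tendsto.comp
      ((hlim q).prodMk_nhds tendsto_const_nhds)
    refine tendsto_nhds_unique (hlim y) (hmlim.congr' ?_)
    filter_upwards [hev] with i hi
    exact (hformulaMN _ hi y hy _ (Γ i).2 rfl).symm
  · filter_upwards [hev] with i hi
    refine ⟨hsmoothMN _ hi q hqN, ?_⟩
    filter_upwards [hN.mem_nhds hqN] with y hy
    exact hformulaMN _ hi y hy _ (Γ i).2 rfl

theorem contMDiff_limit (hH : HasLocalFormula H)
    (hΦ : ∀ q, Tendsto (fun i => (Γ i).1 q) l (𝓝 (Φ q))) :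
    ContMDiff 𝓘(ℝ, W) 𝓘(ℝ, W) ∞ Φ := by
  intro q
  obtain ⟨m, hm, hform, -⟩ := hH.exists_limit_formula hΦ q
  have hsnd : ContMDiffAt 𝓘(ℝ, W) 𝓘(ℝ, W) ∞ (fun y : W => m (Φ q, y)) q :=
    (hm.comp (f := fun y : W => ((Φ q : W), y)) (q : W) (by fun_prop)).contMDiffAt
  exact (ContMDiffAt.subtypeVal_comp_iff U Φ q).1
    ((contMDiffAt_subtype_iff.2 hsnd).congr_of_eventuallyEq hform)

theorem tendsto_fderiv_limit (hH : HasLocalFormula H)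
    (hΦ : ∀ q, Tendsto (fun i => (Γ i).1 q) l (𝓝 (Φ q))) {F : ι → W → W} {F' : W → W}
    (hF : ∀ i (p : U), ((Γ i).1 p : W) = F i p) (hF' : ∀ p : U, (Φ p : W) = F' p) (q : U) :
    Tendsto (fun i => fderiv ℝ (F i) q) l (𝓝 (fderiv ℝ F' q)) := by
  obtain ⟨m, hm, hform, hev⟩ := hH.exists_limit_formula hΦ q
  have hfderiv : ∀ {G : W → W} {a : W}, ContDiffAt ℝ ∞ m (a, q) →
      (∀ᶠ y : U in 𝓝 q, G y = m (a, y)) →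
      fderiv ℝ G q = fderiv ℝ m (a, q) ∘L .inr ℝ W W := by
    intro G a ha hG
    have hd := (ha.differentiableAt (by simp)).hasFDerivAt.comp (q : W)
      (hasFDerivAt_prodMk_right a (q : W))
    refine (hd.congr_of_eventuallyEq ?_).fderiv
    rw [EventuallyEq, ← U.isOpenEmbedding'.map_nhds_eq q]
    exact eventually_map.2 hG
  have hlim : Tendsto (fun i => fderiv ℝ m ((Γ i).1 q, q)) l (𝓝 (fderiv ℝ m (Φ q, q))) :=
    (hm.fderiv_right (m := ∞) (by simp)).continuousAt.tendsto.comp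
      (((continuous_subtype_val.tendsto _).comp (hΦ q)).prodMk_nhds tendsto_const_nhds)
  rw [hfderiv hm (hform.mono fun y hy => by rw [← hF', hy])]
  refine (((ContinuousLinearMap.precomp W
    (ContinuousLinearMap.inr ℝ W W)).continuous.tendsto _).comp hlim).congr' ?_
  filter_upwards [hev] with i hi
  exact (hfderiv hi.1 (hi.2.mono fun y hy => by rw [← hF, hy])).symm

theorem apply_limit_symm (hH : HasLocalFormula H) {Ψ : U → U}
    (hΦ : ∀ q, Tendsto (fun i => (Γ i).1 q) l (𝓝 (Φ q)))
    (hΨ : ∀ q, Tendsto (fun i => (Γ i).1.symm q) l (𝓝 (Ψ q))) (q : U) : Φ (Ψ q) = q := by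
  have h := hH.tendsto_apply_of_tendsto tendsto_const_nhds (hΦ (Ψ q)) (hΨ q)
  simp only [Homeomorph.apply_symm_apply] at h
  exact tendsto_nhds_unique h tendsto_const_nhds

theorem exists_homeomorph_limit (hH : HasLocalFormula H) {Ψ : U → U}
    (hΦ : ∀ q, Tendsto (fun i => (Γ i).1 q) l (𝓝 (Φ q)))
    (hΨ : ∀ q, Tendsto (fun i => (Γ i).1.symm q) l (𝓝 (Ψ q))) :
    ∃ Θ : U ≃ₜ U, ⇑Θ = Φ ∧ ⇑Θ.symm = Ψ :=
  ⟨{ toFun := Φ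
     invFun := Ψ
     left_inv := hH.apply_limit_symm (Γ := fun i => (Γ i)⁻¹) hΨ hΦ
     right_inv := hH.apply_limit_symm hΦ hΨ
     continuous_toFun := (hH.contMDiff_limit hΦ).continuous
     continuous_invFun := (hH.contMDiff_limit (Γ := fun i => (Γ i)⁻¹) hΨ).continuous }, rfl, rfl⟩

end HasLocalFormula

section WebLimit

open Filter

variable {n : ℕ} {U : Opens (TX n)} {f : (Fin n → ℝ) → Fin n → ℝ} {ι : Type*} {l : Filter ι}
  [l.NeBot] {i j : Fin n}

theorem isWebMap_iff {Φ : U → U} : IsWebMap Φ ↔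
    (∀ p p' : U, p.1.1 = p'.1.1 → (Φ p).1.1 = (Φ p').1.1) ∧
      ∀ i, ∀ p p' : U, p.1.2 i = p'.1.2 i → (Φ p).1.2 i = (Φ p').1.2 i := by
  constructor
  · rintro ⟨φ₀, φ, h⟩
    exact ⟨fun p p' hp => by simp [h, hp], fun i p p' hp => by simp [h, hp]⟩
  · rintro ⟨h0, h⟩
    have hfactors : ∀ {c v : U → ℝ}, (∀ p p', c p = c p' → v p = v p') →
        ∃ φ : ℝ → ℝ, ∀ p, v p = φ (c p) := fun {c v} hcv =>
      ⟨Function.extend c v 0, fun p =>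
        (Function.FactorsThrough.extend_apply (fun a b => hcv a b) 0 p).symm⟩
    obtain ⟨φ₀, hφ₀⟩ := hfactors h0
    choose φ hφ using fun i => hfactors (h i)
    exact ⟨φ₀, φ, fun p => Prod.ext (hφ₀ p) (funext fun i => hφ i p)⟩

theorem isWebMap_limit {Γ : ι → U → U} {Φ : U → U} (hΓ : ∀ a, IsWebMap (Γ a))
    (hΦ : ∀ q, Tendsto (fun a => Γ a q) l (𝓝 (Φ q))) : IsWebMap Φ := by
  have hfst : ∀ p, Tendsto (fun a => (Γ a p).1.1) l (𝓝 (Φ p).1.1) := fun p =>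
    (Continuous.tendsto (f := fun x : U => x.1.1) (by fun_prop) _).comp (hΦ p)
  have hsnd : ∀ k p, Tendsto (fun a => (Γ a p).1.2 k) l (𝓝 ((Φ p).1.2 k)) := fun k p =>
    (Continuous.tendsto (f := fun x : U => x.1.2 k) (by fun_prop) _).comp (hΦ p)
  refine isWebMap_iff.2 ⟨fun p p' hp => ?_, fun k p p' hp => ?_⟩
  · exact tendsto_nhds_unique (hfst p)
      ((hfst p').congr fun a => ((isWebMap_iff.1 (hΓ a)).1 p p' hp).symm)
  · exact tendsto_nhds_unique (hsnd k p)
      ((hsnd k p').congr fun a => ((isWebMap_iff.1 (hΓ a)).2 k p p' hp).symm)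

theorem deriv_mul_eq_limit {Γ : ι → webSymmetrySubgroup f U} {Φ : U → U}
    {φ₀ : ℝ → ℝ} {φ : Fin n → ℝ → ℝ} (hH : HasLocalFormula (webSymmetrySubgroup f U))
    (hf : ContDiffOn ℝ ∞ f (Prod.snd '' (U : Set (TX n))))
    (hΦ : ∀ q, Tendsto (fun a => (Γ a).1 q) l (𝓝 (Φ q)))
    (hw : ∀ p : U, (Φ p : TX n) = webFun φ₀ φ p) (p : U) (k : Fin n) :
    deriv (φ k) (p.1.2 k) * f p.1.2 k = deriv φ₀ p.1.1 * f (Φ p).1.2 k := by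
  have hsymm : ∀ a, IsWebSymmetry f (Γ a).1 := fun a => (Γ a).2
  choose γ₀ γ hγ using fun a => (hsymm a).web.exists_eq_webFun
  have hfderiv : Tendsto (fun a => fderiv ℝ (webFun (γ₀ a) (γ a)) p (1, f p.1.2)) l
      (𝓝 (fderiv ℝ (webFun φ₀ φ) p (1, f p.1.2))) :=
    ((ContinuousLinearMap.apply ℝ (TX n) ((1, f p.1.2) : TX n)).continuous.tendsto _).comp
      (hH.tendsto_fderiv_limit hΦ hγ hw p)
  rw [fderiv_webFun (differentiableAt_of_contMDiffAt hw (hH.contMDiff_limit hΦ p))] at hfderiv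
  simp only [fderiv_webFun (differentiableAt_of_contMDiffAt (hγ _) ((hsymm _).smooth p)),
    mul_one] at hfderiv
  have hsnd : Tendsto (fun a => deriv (γ a k) (p.1.2 k) * f p.1.2 k) l
      (𝓝 (deriv (φ k) (p.1.2 k) * f p.1.2 k)) :=
    (Continuous.tendsto (f := fun v : TX n => v.2 k) (by fun_prop) _).comp hfderiv
  have hfst : Tendsto (fun a => deriv (γ₀ a) p.1.1) l (𝓝 (deriv φ₀ p.1.1)) :=
    (continuous_fst.tendsto _).comp hfderiv
  have hfΦ : Tendsto (fun a => f ((Γ a).1 p).1.2 k) l (𝓝 (f (Φ p).1.2 k)) :=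
    (contDiffAt_pi.1 (contDiffAt_snd_of_mem hf (Φ p).2) k).continuousAt.tendsto.comp
      ((Continuous.tendsto (f := fun x : U => x.1.2) (by fun_prop) _).comp (hΦ p))
  exact tendsto_nhds_unique hsnd
    ((hfst.mul hfΦ).congr fun a => ((hsymm a).deriv_mul_eq (hγ a) p k).symm)

theorem rigidGroup_webSymmetry (hf : IsEllRegular f U i j) :
    RigidGroup (webSymmetrySubgroup f U) := by
  have hH := hasLocalFormula_webSymmetry hf
  refine ⟨hH, fun l _ Φ Ψ hΦ hΨ => ?_⟩
  obtain ⟨Θ, rfl, rfl⟩ := hH.exists_homeomorph_limit (Γ := id) hΦ hΨ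
  have hweb : IsWebMap Θ :=
    isWebMap_limit (fun g : webSymmetrySubgroup f U => IsWebSymmetry.web g.2) hΦ
  have hweb' : IsWebMap Θ.symm :=
    isWebMap_limit (fun g : webSymmetrySubgroup f U => IsWebSymmetry.web_symm g.2) hΨ
  obtain ⟨φ₀, φ, hw⟩ := hweb.exists_eq_webFun
  exact ⟨⟨Θ, isWebSymmetry_of_deriv_mul_eq (hH.contMDiff_limit (Γ := id) hΦ)
    (hH.contMDiff_limit (Γ := fun g => g⁻¹) hΨ) hw hweb'
    (deriv_mul_eq_limit (Γ := id) hH hf.contDiffOn hΦ hw)⟩, fun q => rfl⟩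

end WebLimit

theorem mainTheorem1 (n : ℕ) (hn : 2 ≤ n) (U : Opens (TX n)) (hU : IsConnected (U : Set (TX n)))
    (f : (Fin n → ℝ) → Fin n → ℝ) (hf : ContDiffOn ℝ ∞ f (Prod.snd '' (U : Set (TX n))))
    (hf0 : ∀ p ∈ U, ∀ i, f p.2 i ≠ 0)
    (hell : ∃ i j : Fin n, i ≠ j ∧ ∀ p ∈ U, ell f i j p.2 ≠ 0) :
    T2Space (WebSymmetryGroup f U) ∧ SecondCountableTopology (WebSymmetryGroup f U) ∧
    ∃ k : ℕ, k ≤ n + 1 ∧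
      ∃ _ : ChartedSpace (EuclideanSpace ℝ (Fin k)) (WebSymmetryGroup f U),
        LieGroup (𝓡 k) ∞ (WebSymmetryGroup f U) ∧
        ContMDiff ((𝓡 k).prod 𝓘(ℝ, TX n)) 𝓘(ℝ, TX n) ∞
          (fun q : WebSymmetryGroup f U × U => q.1.1 q.2) := by
  obtain ⟨i, j, hij, hell⟩ := hell
  have hrigid := rigidGroup_webSymmetry ⟨hf, hf0, hij, hell⟩
  have : PreconnectedSpace U := isPreconnected_iff_preconnectedSpace.1 hU.isPreconnected
  obtain ⟨o, ho⟩ := hU.nonempty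
  have hτ : IsInducing fun g : WebSymmetryGroup f U => (⟨g.1, g.1.continuous⟩ : C(U, U)) := ⟨rfl⟩
  have horbit := hrigid.isEmbedding_apply hτ ⟨o, ho⟩
  obtain ⟨k, hk, hcharts, hLie, hact⟩ := hrigid.exists_lieGroup hτ ⟨o, ho⟩
  refine ⟨horbit.t2Space, horbit.secondCountableTopology, k, ?_, hcharts, hLie, hact⟩
  simpa [add_comm] using hk
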